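/- **Setting.** Rings are associative, not necessarily unital. An odd form ring \((R,\Delta)\) consists of a ring \(R\) with involution \(x\mapsto\bar x\), a (not necessarily commutative, additively written) group \(\Delta\) with a right action \((u,x)\mapsto u\cdot x\) of the multiplicative semigroup of \(R\) by group endomorphisms, and maps \(\phi\colon R\to\Delta\), \(\pi\colon\Delta\to R\), \(\rho\colon\Delta\to R\) such that \(\pi,\phi\) are group homomorphisms, \(\pi(u\cdot x)=\pi(u)x\), \(\phi(\bar x y x)=\phi(y)\cdot x\), \(\phi(x)=0\) if \(\bar x=x\), \(u+\phi(x)=\phi(x)+u\), \(u+v=v+u+\phi(-\overline{\pi(u)}\pi(v))\), \(\rho(u+v)=\rho(u)-\overline{\pi(u)}\pi(v)+\rho(v)\), \(\overline{\rho(u)}=\rho(-u)\), \(\rho(u\cdot x)=\bar x\rho(u)x\), \(\pi(\phi(x))=0\), \(\rho(\phi(x))=x-\bar x\), \(u\cdot(x+y)=u\cdot x+\phi(\bar y\rho(u)x)+u\cdot y\). Put \(u\cdot(1+y)=u\cdot y+\phi(\rho(u)y)+u\). Morphisms of odd form rings are pairs of an involution ring homomorphism and a group homomorphism, both written \(a\mapsto{}^f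 a\), compatible with all operations; \(\mathrm{Hom}(S,\Theta;R,\Delta)\) is the set of morphisms. The unitary group \(U(R,\Delta)\) consists of the pairs \(g=(\beta(g),\gamma(g))\in R\times\Delta\) such that \(\alpha(g)=1+\beta(g)\in R\rtimes\mathbb Z\) satisfies \(\alpha(g)^{-1}=\overline{\alpha(g)}\), and \(\pi(\gamma(g))=\beta(g)\), \(\rho(\gamma(g))=\overline{\beta(g)}\); the product is \(\alpha(gh)=\alpha(g)\alpha(h)\), \(\gamma(gh)=\gamma(g)\cdot\alpha(h)+\gamma(h)\). It acts on \((R,\Delta)\) by \({}^gx=\alpha(g)x\alpha(g)^{-1}\), \({}^gu=(\gamma(g)\cdot\pi(u)+u)\cdot\overline{\alpha(g)}\), and hence from the left on \(\mathrm{Hom}(S,\Theta;R,\Delta)\) by composition. For hermitian idempotents \(e,e'\in R\) let \(U(e,e';R,\Delta)\) be the set of pairs \((\beta,\gamma)\in R\times\Delta\), \(\gamma\in\Delta\cdot e'\), such that \(\alpha=\beta+e'\in eRe'\), \(\bar\alpha\alpha=e'\), \(\alpha\bar\alpha=e\), \(\pi(\gamma)=\beta\), \(\rho(\gamma)=\bar\beta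 e'\). A hyperbolic pair is \(\eta=(e_-,e_+,q_-,q_+)\) with orthogonal idempotents \(e_\pm\in R\), \(\overline{e_+}=e_-\), and \(q_\pm\in\Delta\), \(\pi(q_\pm)=e_\pm\), \(\rho(q_\pm)=0\), \(q_\pm\cdot e_\pm=q_\pm\). A free orthogonal hyperbolic family of rank \(n\) is a sequence of hyperbolic pairs \(\eta_i=(e_{-i},e_i,q_{-i},q_i)\), \(1\le i\le n\), such that, with \(e_{|i|}=e_{-i}+e_i\), one has \(e_{|i|}e_{|j|}=0\) and \(e_{|i|}Re_{|j|}Re_{|i|}=e_{|i|}Re_{|i|}\) for \(i\ne j\) (products of subsets mean the additive subgroups generated), and there are \(e_{ij}\in R\) (\(1\le i,j\le n\)) with \(e_{ii}=e_i\), \(e_{ij}e_{jk}=e_{ik}\), \(q_i\cdot e_{ij}=q_j\), \(q_{-j}\cdot\overline{e_{ij}}=q_{-i}\). Put \(\Delta^0=\{u\in\Delta\mid e_k\pi(u)=0\text{ for all }0<|k|\le n\}\). The elementary group \(EU(n;R,\Delta)\le U(R,\Delta)\) is generated by the elements \(T_{ij}(x)\) (\(i,j\ne0\), \(i\ne\pm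 j\), \(x\in e_iRe_j\)) with \(\beta=x-\bar x\), \(\gamma=q_i\cdot x+q_{-j}\cdot(-\bar x)-\phi(x)\), and \(T_i(u)\) (\(i\ne0\), \(u\in\Delta^0\cdot e_i\)) with \(\beta=\rho(u)+\pi(u)-\overline{\pi(u)}\), \(\gamma=u-\phi(\rho(u)+\pi(u))+q_{-i}\cdot(\rho(u)-\overline{\pi(u)})\). Let \(R_1=e_1Re_1\), \(R_{\pm1,\mp1}=e_{\pm1}Re_{\mp1}\). A sequence \(x_1,\dots,x_k\) in \(R_1\) is right unimodular if \(\sum_iy_ix_i=e_1\) for some \(y_i\in R_1\). The condition \(\mathrm{sr}(R_1)\le k-1\) means that for every right unimodular \(x_1,\dots,x_k\in R_1\) there are \(a_i\in R_1\) such that \(x_1+a_1x_k,\dots,x_{k-1}+a_{k-1}x_k\) is right unimodular. Let \(\Delta^{\mathrm{ev}}=\{\rho(u)\mid u\in\Delta\cdot(e_{|1|}+\dots+e_{|n|}),\ \pi(u)=0\}\). The condition \(\Lambda\mathrm{sr}(\eta_1;R,\Delta)\le k-1\) means that \(\mathrm{sr}(R_1)\le k-1\) and for all \(x_{-k},\dots,x_{-1}\in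 R_{-1,1}\), \(x_1,\dots,x_k\in R_1\) such that \(\sum_iy_ix_i=e_1\) for some \(y_{-k},\dots,y_{-1}\in R_{1,-1}\), \(y_1,\dots,y_k\in R_1\), there are \(a_{ij}\in R_{1,-1}\) (\(1\le i\le k\), \(-k\le j\le-1\)) with \(a_{ij}=-\overline{a_{-j,-i}}\), \(a_{i,-i}\in\Delta^{\mathrm{ev}}\), such that the sequence \(x_i+\sum_{j=-k}^{-1}a_{ij}x_j\), \(1\le i\le k\), is right unimodular. **Proposition.** Let \((S,\Theta)\) and \((R,\Delta)\) be odd form rings with free orthogonal hyperbolic families of ranks \(m\ge1\) and \(n\ge1\) (the idempotents of both families are denoted by \(e_i\)). Put \[\mathrm{Hom}^*(m;S,\Theta;n;R,\Delta)=\{f\in\mathrm{Hom}(S,\Theta;R,\Delta)\mid U({}^fe_{|m|},e_{|n|};R,\Delta)\ne\varnothing\},\] \[\mathrm{Hom}_{mn}(m;S,\Theta;n;R,\Delta)=\{f\in\mathrm{Hom}(S,\Theta;R,\Delta)\mid{}^fe_{|m|}=e_{|n|}\}.\] If \(\Lambda\mathrm{sr}(\eta_1;R,\Delta)\le n-1\),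 then \[\mathrm{Hom}^*(m;S,\Theta;n;R,\Delta)=EU(n;R,\Delta)\,\mathrm{Hom}_{mn}(m;S,\Theta;n;R,\Delta).\] -/

import Mathlib

/-- An odd form ring `(R, Δ)`: `R` is an associative, not necessarily unital, ring with involution
`star`; `Δ` is a (not necessarily commutative) group, written additively, on which the
multiplicative semigroup of `R` acts from the right by group endomorphisms (`act u x` is `u · x`);
and there are maps `φ : R → Δ`, `π : Δ → R`, `ρ : Δ → R` satisfying the usual axioms. -/
class OddFormRing (R Δ : Type*) [NonUnitalRing R] [StarRing R] [AddGroup Δ] where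
  act : Δ → R → Δ
  phi : R → Δ
  pi : Δ → R
  rho : Δ → R
  act_add_left : ∀ (u v : Δ) (x : R), act (u + v) x = act u x + act v x
  act_mul : ∀ (u : Δ) (x y : R), act u (x * y) = act (act u x) y
  pi_add : ∀ u v : Δ, pi (u + v) = pi u + pi v
  pi_act : ∀ (u : Δ) (x : R), pi (act u x) = pi u * x
  phi_add : ∀ x y : R, phi (x + y) = phi x + phi y
  phi_conj : ∀ x y : R, phi (star x * y * x) = act (phi y) x
  phi_herm : ∀ x : R, star x = x → phi x = 0
  add_phi : ∀ (u : Δ) (x : R), u + phi x = phi x + u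
  add_swap : ∀ u v : Δ, u + v = v + u + phi (-(star (pi u) * pi v))
  rho_add : ∀ u v : Δ, rho (u + v) = rho u - star (pi u) * pi v + rho v
  star_rho : ∀ u : Δ, star (rho u) = rho (-u)
  rho_act : ∀ (u : Δ) (x : R), rho (act u x) = star x * rho u * x
  pi_phi : ∀ x : R, pi (phi x) = 0
  rho_phi : ∀ x : R, rho (phi x) = x - star x
  act_add : ∀ (u : Δ) (x y : R), act u (x + y) = act u x + phi (star y * rho u * x) + act u y

namespace OddFormRing

section Basic

variable {R Δ : Type*} [NonUnitalRing R] [StarRing R] [AddGroup Δ] [OddFormRing R Δ]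

theorem phi_zero : (phi (0 : R) : Δ) = 0 := phi_herm 0 (star_zero R)

theorem phi_neg (x : R) : (phi (-x) : Δ) = -phi x := by
  have h : (phi (-x) : Δ) + phi x = 0 := by rw [← phi_add, neg_add_cancel, phi_zero]
  exact eq_neg_of_add_eq_zero_left h

theorem phi_star (x : R) : (phi (star x) : Δ) = -phi x := by
  have h : (phi (star x) : Δ) + phi x = 0 := by
    rw [← phi_add]; exact phi_herm _ (by rw [star_add, star_star, add_comm])
  exact eq_neg_of_add_eq_zero_left h

theorem pi_zero : pi (0 : Δ) = (0 : R) := by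
  have h := pi_add (R := R) (0 : Δ) 0
  rw [add_zero] at h
  exact left_eq_add.mp h

theorem pi_neg (u : Δ) : pi (-u) = -(pi u : R) := by
  have h := pi_add (R := R) (-u) u
  rw [neg_add_cancel, pi_zero] at h
  exact eq_neg_of_add_eq_zero_left h.symm

theorem rho_zero : rho (0 : Δ) = (0 : R) := by
  have h := rho_add (R := R) (0 : Δ) 0
  rw [add_zero, pi_zero, mul_zero, sub_zero] at h
  exact left_eq_add.mp h

theorem rho_add_star (u : Δ) : rho u + star (rho u) = -(star (pi u) * (pi u : R)) := by
  have h := rho_add (R := R) u (-u)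
  rw [add_neg_cancel, rho_zero, pi_neg, ← star_rho, mul_neg, sub_neg_eq_add] at h
  rw [eq_neg_iff_add_eq_zero, h]; abel

theorem act_zero_left (x : R) : act (0 : Δ) x = 0 := by
  have h := act_add_left (R := R) (0 : Δ) 0 x
  rw [add_zero] at h
  exact left_eq_add.mp h

theorem act_neg_left (u : Δ) (x : R) : act (-u) x = -act u x := by
  have h := act_add_left (-u) u x
  rw [neg_add_cancel, act_zero_left] at h
  exact eq_neg_of_add_eq_zero_left h.symm

theorem act_zero (u : Δ) : act u (0 : R) = 0 := by
  have h := act_add u (0 : R) 0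
  rw [mul_zero, phi_zero, add_zero, add_zero] at h
  exact left_eq_add.mp h

/-- `act1 u y` is `u · (1 + y)`, the action of the element `1 + y` of `R ⋊ ℤ` on `u`
(with `u · 1 = u`). -/
def act1 (u : Δ) (y : R) : Δ := act u y + phi (rho u * y) + u

theorem act1_zero (u : Δ) : act1 u (0 : R) = u := by
  rw [act1, act_zero, mul_zero, phi_zero, zero_add, zero_add]

theorem pi_act1 (u : Δ) (y : R) : pi (act1 u y) = pi u + pi u * y := by
  rw [act1, pi_add, pi_add, pi_act, pi_phi, add_zero, add_comm]

theorem act_act1 (u : Δ) (x y : R) : act1 (act u x) y = act u (x + x * y) := by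
  rw [add_comm x, act_add, act1, act_mul, rho_act, mul_assoc (star x * rho u)]

theorem act1_act (u : Δ) (x y : R) : act (act1 u y) x = act u (x + y * x) := by
  rw [add_comm x, act_add, act1, act_add_left, act_add_left, act_mul, ← phi_conj]
  simp only [mul_assoc]

theorem phi_left_comm (x : R) (u v : Δ) : phi x + (u + v) = u + (phi x + v) := by
  rw [← add_assoc, ← add_phi, add_assoc]

theorem act1_add_left (u v : Δ) (y : R) : act1 (u + v) y = act1 u y + act1 v y := by
  have h : u + act v y = act v y + (u + phi (-(star (pi u) * (pi v * y)))) := by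
    rw [add_swap (R := R), pi_act, add_assoc]
  have h2 : (rho u - star (pi u) * pi v + rho v) * y
      = rho u * y + (-(star (pi u) * (pi v * y)) + rho v * y) := by noncomm_ring
  simp only [act1, act_add_left, rho_add, h2, phi_add, add_assoc]
  rw [← add_assoc u (act v y), h]
  simp only [add_assoc]
  rw [phi_left_comm _ (act v y), phi_left_comm (rho v * y) u, phi_left_comm _ u]

theorem rho_act1 (u : Δ) (y : R) :
    rho (act1 u y) = rho u + star y * rho u + rho u * y + star y * rho u * y := by
  have h : star (rho u) = -(star (pi u) * (pi u : R)) - rho u := by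
    rw [← rho_add_star]; abel
  simp only [act1, rho_add, rho_act, rho_phi, pi_add, pi_act, pi_phi, star_mul, h, add_zero,
    mul_zero, sub_zero]
  noncomm_ring

theorem act1_act1 (u : Δ) (y z : R) : act1 (act1 u y) z = act1 u (y + z + y * z) := by
  have e : y + z + y * z = (z + y * z) + y := by abel
  have h2 : (rho u + star y * rho u + rho u * y + star y * rho u * y) * z
      = star y * rho u * (z + y * z) + (rho u * (z + y * z)) := by noncomm_ring
  rw [act1, act1_act, rho_act1, h2, act1, act1, e, act_add u (z + y * z) y, phi_add, mul_add (rho u) _ y, phi_add]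
  simp only [add_assoc]
  rw [phi_left_comm _ (act u y)]

end Basic

end OddFormRing

open OddFormRing

/-- The unitary group `U(R, Δ)`: pairs `g = (β, γ) ∈ R × Δ` such that `α = 1 + β ∈ R ⋊ ℤ` satisfies
`α⁻¹ = star α` (spelled out in terms of `β`), `π(γ) = β` and `ρ(γ) = star β`. -/
@[ext]
structure OddUnitary (R Δ : Type*) [NonUnitalRing R] [StarRing R] [AddGroup Δ]
    [OddFormRing R Δ] where
  beta : R
  gamma : Δ
  beta_mul_star : beta * star beta + beta + star beta = 0
  star_mul_beta : star beta * beta + beta + star beta = 0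
  pi_gamma : pi gamma = beta
  rho_gamma : rho gamma = star beta

namespace OddUnitary

variable {R Δ : Type*} [NonUnitalRing R] [StarRing R] [AddGroup Δ] [OddFormRing R Δ]

theorem mul_star_eq (g : OddUnitary R Δ) : g.beta * star g.beta = -g.beta - star g.beta := by
  rw [← sub_eq_zero, ← g.beta_mul_star]; abel

theorem star_mul_eq (g : OddUnitary R Δ) : star g.beta * g.beta = -g.beta - star g.beta := by
  rw [← sub_eq_zero, ← g.star_mul_beta]; abel

theorem mul_star_beta_zero (g : OddUnitary R Δ) :
    star g.beta + g.beta + star g.beta * g.beta = 0 := by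
  rw [g.star_mul_eq]; abel

/-- The product: `α(gh) = α(g) α(h)` and `γ(gh) = γ(g) · α(h) + γ(h)`. -/
instance : Mul (OddUnitary R Δ) where
  mul g h :=
    { beta := g.beta * h.beta + g.beta + h.beta
      gamma := act1 g.gamma h.beta + h.gamma
      beta_mul_star := by
        have hg := g.mul_star_eq
        have hh := h.mul_star_eq
        simp only [star_add, star_mul]
        have e : (g.beta * h.beta + g.beta + h.beta) *
              (star h.beta * star g.beta + star g.beta + star h.beta) =
            g.beta * (h.beta * star h.beta) * star g.beta + g.beta * (h.beta * star h.beta)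
            + (h.beta * star h.beta) * star g.beta + (h.beta * star h.beta)
            + g.beta * h.beta * star g.beta + g.beta * star h.beta * star g.beta
            + g.beta * star g.beta + g.beta * star h.beta + h.beta * star g.beta := by noncomm_ring
        rw [e, hh, hg]
        noncomm_ring
      star_mul_beta := by
        have hg := g.star_mul_eq
        have hh := h.star_mul_eq
        simp only [star_add, star_mul]
        have e : (star h.beta * star g.beta + star g.beta + star h.beta) *
              (g.beta * h.beta + g.beta + h.beta) =
            star h.beta * (star g.beta * g.beta) * h.beta + star h.beta * (star g.beta * g.beta)
            + (star g.beta * g.beta) * h.beta + (star g.beta * g.beta)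
            + star h.beta * star g.beta * h.beta + star h.beta * g.beta * h.beta
            + star h.beta * h.beta + star h.beta * g.beta + star g.beta * h.beta := by noncomm_ring
        rw [e, hh, hg]
        noncomm_ring
      pi_gamma := by
        rw [pi_add, pi_act1, g.pi_gamma, h.pi_gamma]; abel
      rho_gamma := by
        have hh := h.star_mul_eq
        simp only [rho_add, rho_act1, pi_act1, g.pi_gamma, h.pi_gamma, g.rho_gamma, h.rho_gamma,
          star_add, star_mul]
        have e : star g.beta + star h.beta * star g.beta + star g.beta * h.beta
              + star h.beta * star g.beta * h.beta
              - (star g.beta + star h.beta * star g.beta) * h.beta + star h.beta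
            = star h.beta * star g.beta + star g.beta + star h.beta := by noncomm_ring
        exact e }

instance : One (OddUnitary R Δ) where
  one :=
    { beta := 0
      gamma := 0
      beta_mul_star := by simp
      star_mul_beta := by simp
      pi_gamma := pi_zero
      rho_gamma := by rw [rho_zero, star_zero] }

/-- The inverse: `α(g⁻¹) = star α(g)` and `γ(g⁻¹) = -γ(g) · star α(g)`. -/
instance : Inv (OddUnitary R Δ) where
  inv g :=
    { beta := star g.beta
      gamma := -act1 g.gamma (star g.beta)
      beta_mul_star := by rw [star_star, add_right_comm]; exact g.star_mul_beta
      star_mul_beta := by rw [star_star, add_right_comm]; exact g.beta_mul_star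
      pi_gamma := by
        rw [pi_neg, pi_act1, g.pi_gamma, g.mul_star_eq]; abel
      rho_gamma := by
        rw [← star_rho, rho_act1, g.rho_gamma, star_star, g.mul_star_eq, sub_mul, neg_mul,
          g.mul_star_eq]
        rw [← star_star g.beta]
        congr 1
        rw [star_star]
        abel }

@[simp] theorem beta_mul (g h : OddUnitary R Δ) :
    (g * h).beta = g.beta * h.beta + g.beta + h.beta := rfl
@[simp] theorem gamma_mul (g h : OddUnitary R Δ) :
    (g * h).gamma = act1 g.gamma h.beta + h.gamma := rfl
@[simp] theorem beta_one : (1 : OddUnitary R Δ).beta = 0 := rfl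
@[simp] theorem gamma_one : (1 : OddUnitary R Δ).gamma = 0 := rfl
@[simp] theorem beta_inv (g : OddUnitary R Δ) : (g⁻¹).beta = star g.beta := rfl
@[simp] theorem gamma_inv (g : OddUnitary R Δ) : (g⁻¹).gamma = -act1 g.gamma (star g.beta) := rfl

instance : Group (OddUnitary R Δ) :=
  Group.ofLeftAxioms
    (fun a b c => by
      ext
      · simp only [beta_mul]; noncomm_ring
      · simp only [gamma_mul, beta_mul, act1_add_left, act1_act1, add_assoc]
        congr 2; abel)
    (fun a => by
      ext
      · simp
      · simp [act1, act_zero_left, rho_zero, phi_zero])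
    (fun a => by
      ext
      · simp only [beta_mul, beta_inv, beta_one, a.star_mul_eq]; abel
      · have h : act1 (-act1 a.gamma (star a.beta)) a.beta = -act1 (act1 a.gamma (star a.beta)) a.beta := by
          apply eq_neg_of_add_eq_zero_left
          rw [← act1_add_left, neg_add_cancel]
          simp [act1, act_zero_left, rho_zero, phi_zero]
        simp only [gamma_mul, gamma_inv, gamma_one, h, act1_act1]
        rw [a.mul_star_beta_zero, act1_zero, neg_add_cancel])

end OddUnitary

/-- A morphism of odd form rings `(S, Θ) → (R, Δ)`: a homomorphism of involution rings together
with a group homomorphism, compatible with all the operations. -/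
@[ext]
structure OddFormHom (S Θ R Δ : Type*) [NonUnitalRing S] [StarRing S] [AddGroup Θ]
    [OddFormRing S Θ] [NonUnitalRing R] [StarRing R] [AddGroup Δ] [OddFormRing R Δ] where
  toRing : S →⋆ₙ+* R
  toGroup : Θ →+ Δ
  map_act : ∀ (u : Θ) (x : S), toGroup (act u x) = act (toGroup u) (toRing x)
  map_phi : ∀ x : S, toGroup (phi x) = phi (toRing x)
  map_pi : ∀ u : Θ, toRing (pi u) = pi (toGroup u)
  map_rho : ∀ u : Θ, toRing (rho u) = rho (toGroup u)

namespace OddFormHom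

variable {Q Ξ S Θ R Δ : Type*}
  [NonUnitalRing Q] [StarRing Q] [AddGroup Ξ] [OddFormRing Q Ξ]
  [NonUnitalRing S] [StarRing S] [AddGroup Θ] [OddFormRing S Θ]
  [NonUnitalRing R] [StarRing R] [AddGroup Δ] [OddFormRing R Δ]

/-- Composition of morphisms. -/
def comp (f : OddFormHom S Θ R Δ) (g : OddFormHom Q Ξ S Θ) : OddFormHom Q Ξ R Δ where
  toRing := f.toRing.comp g.toRing
  toGroup := f.toGroup.comp g.toGroup
  map_act u x := by simp [g.map_act, f.map_act]
  map_phi x := by simp [g.map_phi, f.map_phi]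
  map_pi u := by simp [g.map_pi, f.map_pi]
  map_rho u := by simp [g.map_rho, f.map_rho]

end OddFormHom

namespace OddUnitary

variable {R Δ : Type*} [NonUnitalRing R] [StarRing R] [AddGroup Δ] [OddFormRing R Δ]

/-- The value `α(g) x α(g)⁻¹`, with `α(g) = 1 + β(g)`, written out in `R`. -/
def conjRing (g : OddUnitary R Δ) (x : R) : R :=
  (x + g.beta * x) + (x + g.beta * x) * star g.beta

/-- The value `(γ(g) · π(u) + u) · star α(g)`. -/
def conjGroup (g : OddUnitary R Δ) (u : Δ) : Δ :=
  act1 (act g.gamma (pi u : R) + u) (star g.beta)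

theorem conjRing_mul (g : OddUnitary R Δ) (x y : R) :
    g.conjRing (x * y) = g.conjRing x * g.conjRing y := by
  have e : g.conjRing x * g.conjRing y = g.conjRing (x * y)
      + (x + g.beta * x) * (star g.beta + g.beta + star g.beta * g.beta)
        * (y + y * star g.beta) := by
    simp only [conjRing]; noncomm_ring
  rw [e, g.mul_star_beta_zero, mul_zero, zero_mul, add_zero]

theorem conjRing_star (g : OddUnitary R Δ) (x : R) :
    g.conjRing (star x) = star (g.conjRing x) := by
  simp only [conjRing, star_add, star_mul, star_star]; noncomm_ring

theorem conjRing_add (g : OddUnitary R Δ) (x y : R) :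
    g.conjRing (x + y) = g.conjRing x + g.conjRing y := by
  simp only [conjRing]; noncomm_ring

theorem conjGroup_add (g : OddUnitary R Δ) (u v : Δ) :
    g.conjGroup (u + v) = g.conjGroup u + g.conjGroup v := by
  have h : u + act g.gamma (pi v : R)
      = act g.gamma (pi v : R) + (u + phi (-(star (pi u) * (g.beta * pi v)))) := by
    rw [add_swap (R := R), pi_act, g.pi_gamma, add_assoc]
  have h2 : (phi (star (pi v) * star g.beta * pi u) : Δ)
      = phi (-(star (pi u) * (g.beta * pi v))) := by
    rw [phi_neg, ← phi_star]
    simp only [star_mul, star_star, mul_assoc]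
  rw [conjGroup, conjGroup, conjGroup, ← act1_add_left]
  congr 1
  rw [pi_add, act_add, g.rho_gamma, h2]
  simp only [add_assoc]
  rw [← add_assoc u (act _ _), h]
  simp only [add_assoc]
  rw [phi_left_comm _ (act _ _), phi_left_comm _ u]

theorem pi_conjGroup (g : OddUnitary R Δ) (u : Δ) :
    pi (g.conjGroup u) = g.conjRing (pi u) := by
  simp only [conjGroup, conjRing, pi_act1, pi_add, pi_act, g.pi_gamma]; noncomm_ring

theorem rho_conjGroup (g : OddUnitary R Δ) (u : Δ) :
    rho (g.conjGroup u) = g.conjRing (rho u) := by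
  simp only [conjGroup, conjRing, rho_act1, rho_add, rho_act, pi_act, g.pi_gamma, g.rho_gamma,
    star_mul, star_star]
  noncomm_ring

theorem conjGroup_act (g : OddUnitary R Δ) (u : Δ) (x : R) :
    g.conjGroup (act u x) = act (g.conjGroup u) (g.conjRing x) := by
  rw [conjGroup, conjGroup, act1_act, pi_act, act_mul, ← act_add_left, act_act1]
  congr 1
  have e : g.conjRing x + star g.beta * g.conjRing x = (x + x * star g.beta)
      + (star g.beta + g.beta + star g.beta * g.beta) * (x + x * star g.beta) := by
    simp only [conjRing]; noncomm_ring
  rw [e, g.mul_star_beta_zero, zero_mul, add_zero]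

theorem conjGroup_phi (g : OddUnitary R Δ) (x : R) :
    (g.conjGroup (phi x) : Δ) = phi (g.conjRing x) := by
  rw [conjGroup, pi_phi, act_zero, zero_add, act1, ← phi_conj, rho_phi, star_star, conjRing, sub_mul,
    sub_eq_add_neg, phi_add (x * star g.beta), phi_neg (star x * star g.beta), ← phi_star,
    star_mul, star_star, star_star]
  simp only [← phi_add]
  congr 1
  noncomm_ring

/-- Every `g ∈ U(R, Δ)` acts on `(R, Δ)` by the automorphism
`x ↦ α(g) x α(g)⁻¹`, `u ↦ (γ(g) · π(u) + u) · star α(g)`. -/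
def conj (g : OddUnitary R Δ) : OddFormHom R Δ R Δ where
  toRing :=
    { toFun := g.conjRing
      map_mul' := g.conjRing_mul
      map_zero' := by simp [conjRing]
      map_add' := g.conjRing_add
      map_star' := g.conjRing_star }
  toGroup := AddMonoidHom.mk' g.conjGroup g.conjGroup_add
  map_act := g.conjGroup_act
  map_phi := g.conjGroup_phi
  map_pi u := (g.pi_conjGroup u).symm
  map_rho u := (g.rho_conjGroup u).symm

end OddUnitary

namespace OddFormHom

variable {S Θ R Δ : Type*}
  [NonUnitalRing S] [StarRing S] [AddGroup Θ] [OddFormRing S Θ]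
  [NonUnitalRing R] [StarRing R] [AddGroup Δ] [OddFormRing R Δ]

/-- The natural left action of `U(R, Δ)` on morphisms `(S, Θ) → (R, Δ)`. -/
instance : MulAction (OddUnitary R Δ) (OddFormHom S Θ R Δ) where
  smul g f := g.conj.comp f
  one_smul f := by
    ext x
    · change (1 : OddUnitary R Δ).conjRing (f.toRing x) = f.toRing x
      simp [OddUnitary.conjRing]
    · change (1 : OddUnitary R Δ).conjGroup (f.toGroup x) = f.toGroup x
      simp [OddUnitary.conjGroup, act_zero_left, act1_zero]
  mul_smul g h f := by
    ext x
    · change (g * h).conjRing (f.toRing x) = g.conjRing (h.conjRing (f.toRing x))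
      simp only [OddUnitary.conjRing, OddUnitary.beta_mul, star_add, star_mul]
      noncomm_ring
    · change (g * h).conjGroup (f.toGroup x) = g.conjGroup (h.conjGroup (f.toGroup x))
      generalize f.toGroup x = u
      have e : pi (act1 (act h.gamma (pi u : R) + u) (star h.beta))
          = pi (act h.gamma (pi u : R) + u)
            + (pi (act h.gamma (pi u : R) + u) : R) * star h.beta := pi_act1 _ _
      have e2 : pi u + h.beta * pi u = (pi (act h.gamma (pi u : R) + u) : R) := by
        rw [pi_add, pi_act, h.pi_gamma, add_comm]
      simp only [OddUnitary.conjGroup, OddUnitary.beta_mul, OddUnitary.gamma_mul]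
      rw [e, ← act_act1, ← act1_add_left, act1_act1, act_add_left, act1_act, e2, add_assoc]
      congr 1
      simp only [star_add, star_mul]
      abel

end OddFormHom

/-- A hyperbolic pair `η = (e₋, e₊, q₋, q₊)` in `(R, Δ)`. -/
structure HyperbolicPair (R Δ : Type*) [NonUnitalRing R] [StarRing R] [AddGroup Δ]
    [OddFormRing R Δ] where
  em : R
  ep : R
  qm : Δ
  qp : Δ
  em_idem : em * em = em
  ep_idem : ep * ep = ep
  em_mul_ep : em * ep = 0
  ep_mul_em : ep * em = 0
  star_ep : star ep = em
  pi_qm : pi qm = em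
  rho_qm : rho qm = (0 : R)
  act_qm : act qm em = qm
  pi_qp : pi qp = ep
  rho_qp : rho qp = (0 : R)
  act_qp : act qp ep = qp

/-- The hermitian idempotent `e_{|η|} = e₋ + e₊`. -/
def HyperbolicPair.eAbs {R Δ : Type*} [NonUnitalRing R] [StarRing R] [AddGroup Δ]
    [OddFormRing R Δ] (η : HyperbolicPair R Δ) : R := η.em + η.ep

/-- An orthogonal hyperbolic family of rank `n`: pairwise orthogonal and Morita equivalent
hyperbolic pairs `η₁, …, ηₙ` (`ηᵢ` is `pair (i - 1)`). -/
structure OrthogonalHyperbolicFamily (R Δ : Type*) [NonUnitalRing R] [StarRing R] [AddGroup Δ]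
    [OddFormRing R Δ] (n : ℕ) where
  pair : Fin n → HyperbolicPair R Δ
  orth : ∀ i j, i ≠ j → (pair i).eAbs * (pair j).eAbs = 0
  morita : ∀ i j, i ≠ j →
    (AddSubgroup.closure
      {x : R | ∃ r s : R, x = (pair i).eAbs * r * (pair j).eAbs * s * (pair i).eAbs} : Set R)
      = {x : R | ∃ r : R, x = (pair i).eAbs * r * (pair i).eAbs}

namespace OrthogonalHyperbolicFamily

variable {R Δ : Type*} [NonUnitalRing R] [StarRing R] [AddGroup Δ] [OddFormRing R Δ] {n : ℕ}
  (η : OrthogonalHyperbolicFamily R Δ n)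

/-- The family is free: the pairs are coherently isomorphic through elements `e_{ij}`,
`1 ≤ i, j ≤ n` (the first two conditions force `e_{ij} ∈ eᵢ R eⱼ`). -/
def IsFree : Prop :=
  ∃ E : Fin n → Fin n → R,
    (∀ i, E i i = (η.pair i).ep) ∧ (∀ i j k, E i j * E j k = E i k) ∧
    (∀ i j, act (η.pair i).qp (E i j) = (η.pair j).qp) ∧
    (∀ i j, act (η.pair j).qm (star (E i j)) = (η.pair i).qm)

/-- The nonzero indices `-n, …, -1, 1, …, n` are encoded as `Fin n × Bool`: the pair `(i, true)`
stands for `i + 1` and `(i, false)` for `-(i + 1)`. This is the index `-k`. -/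
def opp (k : Fin n × Bool) : Fin n × Bool := (k.1, !k.2)

/-- The idempotent `e_k` for a nonzero index `k`. -/
def e (k : Fin n × Bool) : R := if k.2 then (η.pair k.1).ep else (η.pair k.1).em

/-- The element `q_k` for a nonzero index `k`. -/
def q (k : Fin n × Bool) : Δ := if k.2 then (η.pair k.1).qp else (η.pair k.1).qm

theorem star_e (k : Fin n × Bool) : star (η.e k) = η.e (opp k) := by
  obtain ⟨i, b⟩ := k
  cases b <;> simp [e, opp, ← (η.pair i).star_ep]

theorem e_mul_self (k : Fin n × Bool) : η.e k * η.e k = η.e k := by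
  obtain ⟨i, b⟩ := k
  cases b <;> simp [e, (η.pair i).em_idem, (η.pair i).ep_idem]

theorem e_mul_eAbs (k : Fin n × Bool) : η.e k * (η.pair k.1).eAbs = η.e k := by
  obtain ⟨i, b⟩ := k
  cases b <;> simp [e, HyperbolicPair.eAbs, mul_add, (η.pair i).em_idem, (η.pair i).ep_idem,
    (η.pair i).em_mul_ep, (η.pair i).ep_mul_em]

theorem eAbs_mul_e (k : Fin n × Bool) : (η.pair k.1).eAbs * η.e k = η.e k := by
  obtain ⟨i, b⟩ := k
  cases b <;> simp [e, HyperbolicPair.eAbs, add_mul, (η.pair i).em_idem, (η.pair i).ep_idem,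
    (η.pair i).em_mul_ep, (η.pair i).ep_mul_em]

theorem e_mul_e {k l : Fin n × Bool} (h : k ≠ l) : η.e k * η.e l = 0 := by
  by_cases h1 : k.1 = l.1
  · obtain ⟨i, b⟩ := k
    obtain ⟨j, c⟩ := l
    obtain rfl : i = j := h1
    cases b <;> cases c <;>
      simp_all [e, (η.pair i).em_mul_ep, (η.pair i).ep_mul_em]
  · rw [← η.e_mul_eAbs k, ← η.eAbs_mul_e l, mul_assoc, ← mul_assoc (η.pair k.1).eAbs,
      η.orth _ _ h1, zero_mul, mul_zero]

theorem pi_q (k : Fin n × Bool) : pi (η.q k) = η.e k := by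
  obtain ⟨i, b⟩ := k
  cases b <;> simp [e, q, (η.pair i).pi_qp, (η.pair i).pi_qm]

theorem rho_q (k : Fin n × Bool) : rho (η.q k) = (0 : R) := by
  obtain ⟨i, b⟩ := k
  cases b <;> simp [q, (η.pair i).rho_qp, (η.pair i).rho_qm]

theorem opp_opp (k : Fin n × Bool) : opp (opp k) = k := by
  simp [opp]

theorem opp_ne (k : Fin n × Bool) : opp k ≠ k := by
  obtain ⟨i, b⟩ := k
  cases b <;> simp [opp]

/-- If `x = x eₖ`, `y = eₗ y` and `k ≠ l`, then `x y = 0`. -/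
theorem mul_eq_zero_of {k l : Fin n × Bool} (h : k ≠ l) {x y : R} (hx : x * η.e k = x)
    (hy : η.e l * y = y) : x * y = 0 := by
  rw [← hx, ← hy, mul_assoc, ← mul_assoc (η.e k), η.e_mul_e h, zero_mul, mul_zero]

theorem opp_ne_opp {k l : Fin n × Bool} (h : k ≠ l) : opp k ≠ opp l := fun h' =>
  h (by rw [← opp_opp k, h', opp_opp])

theorem left_of_corner {k l : Fin n × Bool} {x : R} (hx : η.e k * x * η.e l = x) :
    η.e k * x = x := by
  rw [← hx, ← mul_assoc, ← mul_assoc, η.e_mul_self]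

theorem right_of_corner {k l : Fin n × Bool} {x : R} (hx : η.e k * x * η.e l = x) :
    x * η.e l = x := by
  rw [← hx, mul_assoc, η.e_mul_self]

theorem star_left {k : Fin n × Bool} {x : R} (hx : η.e k * x = x) :
    star x * η.e (opp k) = star x := by
  rw [← η.star_e, ← star_mul, hx]

theorem star_right {k : Fin n × Bool} {x : R} (hx : x * η.e k = x) :
    η.e (opp k) * star x = star x := by
  rw [← η.star_e, ← star_mul, hx]

/-- The elementary transvection of short root type `T_{ij}(x)`, for `x ∈ eᵢ R eⱼ`
(only `i ≠ ±j` is used below). Its `β` is `x - star x` and the zero component of its `γ` is `-φ(x)`; the other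
components of `γ` are always `qₖ · β`, which are `qᵢ · x` for `k = i`, `q₋ⱼ · (-star x)` for
`k = -j`, and `0` for the remaining `k ≠ 0`. -/
def shortT (i j : Fin n × Bool) (hij : i ≠ j) (x : R)
    (hx : η.e i * x * η.e j = x) : OddUnitary R Δ where
  beta := x - star x
  gamma := act (η.q i) x + act (η.q (opp j)) (-star x) + -phi x
  beta_mul_star := by
    have l := η.left_of_corner hx
    have r := η.right_of_corner hx
    have h1 : x * x = 0 := η.mul_eq_zero_of hij.symm r l
    have h2 : x * star x = 0 := η.mul_eq_zero_of (opp_ne j).symm r (η.star_right r)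
    have h3 : star x * x = 0 := η.mul_eq_zero_of (opp_ne i) (η.star_left l) l
    have h4 : star x * star x = 0 :=
      η.mul_eq_zero_of (opp_ne_opp hij) (η.star_left l) (η.star_right r)
    simp only [star_sub, star_star, sub_mul, mul_sub, h1, h2, h3, h4]
    abel
  star_mul_beta := by
    have l := η.left_of_corner hx
    have r := η.right_of_corner hx
    have h1 : x * x = 0 := η.mul_eq_zero_of hij.symm r l
    have h2 : x * star x = 0 := η.mul_eq_zero_of (opp_ne j).symm r (η.star_right r)
    have h3 : star x * x = 0 := η.mul_eq_zero_of (opp_ne i) (η.star_left l) l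
    have h4 : star x * star x = 0 :=
      η.mul_eq_zero_of (opp_ne_opp hij) (η.star_left l) (η.star_right r)
    simp only [star_sub, star_star, sub_mul, mul_sub, h1, h2, h3, h4]
    abel
  pi_gamma := by
    have l := η.left_of_corner hx
    have r := η.star_right (η.right_of_corner hx)
    simp only [pi_add, pi_act, pi_neg, pi_phi, pi_q, mul_neg, l, r]
    abel
  rho_gamma := by
    have l := η.left_of_corner hx
    have r := η.right_of_corner hx
    have h4 : star x * star x = 0 :=
      η.mul_eq_zero_of (opp_ne_opp hij) (η.star_left l) (η.star_right r)
    simp only [rho_add, rho_act, rho_q, pi_add, pi_act, pi_neg, pi_phi, pi_q, mul_neg, l,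
      η.star_right r, h4, ← star_rho, rho_phi, star_sub, star_star]
    simp

/-- The subset `Δ⁰ = {u ∈ Δ ∣ π(u) ∈ e₀ R}`, where `e₀ = 1 - ∑_{k ≠ 0} e_k`; that is,
`e_k π(u) = 0` for all `k ≠ 0`. -/
def deltaZero : Set Δ := {u | ∀ k, η.e k * (pi u : R) = 0}

/-- The set `Δ⁰ₖ = Δ⁰ · e_k`. -/
def deltaZeroAt (k : Fin n × Bool) : Set Δ := (fun u : Δ => act u (η.e k)) '' η.deltaZero

theorem deltaZeroAt_spec {i : Fin n × Bool} {u : Δ} (hu : u ∈ η.deltaZeroAt i) :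
    (∀ k, η.e k * pi u = 0) ∧ pi u * η.e i = (pi u : R) ∧
      η.e (opp i) * rho u * η.e i = (rho u : R) := by
  obtain ⟨v, hv, rfl⟩ := hu
  refine ⟨fun k => ?_, ?_, ?_⟩
  · rw [pi_act, ← mul_assoc, hv k, zero_mul]
  · rw [pi_act, mul_assoc, e_mul_self]
  · rw [rho_act, η.star_e, mul_assoc, mul_assoc, mul_assoc, e_mul_self, ← mul_assoc, ← mul_assoc,
      e_mul_self, mul_assoc]

/-- The products occurring in the verification that ultrashort transvections are unitary. -/
theorem ultrashort_products {i : Fin n × Bool} {u : Δ} (hu : u ∈ η.deltaZeroAt i) :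
    (rho u + pi u - star (pi u)) * (star (rho u) + star (pi u) - pi u)
      = star (pi u) * (pi u : R) ∧
    (star (rho u) + star (pi u) - pi u) * (rho u + pi u - star (pi u))
      = star (pi u) * (pi u : R) := by
  obtain ⟨h0, h1, h2⟩ := η.deltaZeroAt_spec hu
  generalize hp : (pi u : R) = p at *
  generalize hr : (rho u : R) = r at *
  have rl := η.left_of_corner h2
  have rr := η.right_of_corner h2
  have sl := η.star_right rr
  have sr := η.star_left rl
  rw [opp_opp] at sr
  have pl := η.star_right h1
  have h0' : ∀ k, star p * η.e k = 0 := fun k => by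
    have h := congrArg star (h0 (opp k))
    rwa [star_mul, star_zero, η.star_e, opp_opp] at h
  -- products ending in `p` or beginning with `star p` vanish unless the other factor is `star p`
  have a1 : r * star r = 0 := η.mul_eq_zero_of (opp_ne i).symm rr sl
  have a2 : r * star p = 0 := η.mul_eq_zero_of (opp_ne i).symm rr pl
  have a3 : r * p = 0 := by rw [← rr, mul_assoc, h0, mul_zero]
  have a4 : p * star r = 0 := η.mul_eq_zero_of (opp_ne i).symm h1 sl
  have a5 : p * star p = 0 := η.mul_eq_zero_of (opp_ne i).symm h1 pl
  have a6 : p * p = 0 := by nth_rw 1 [← h1]; rw [mul_assoc, h0, mul_zero]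
  have a7 : star p * star r = 0 := by rw [← sl, ← mul_assoc, h0', zero_mul]
  have a8 : star p * star p = 0 := by
    nth_rw 2 [← pl]; rw [← mul_assoc, h0', zero_mul]
  have a9 : star r * r = 0 := η.mul_eq_zero_of (opp_ne i).symm sr rl
  have a10 : star r * p = 0 := by rw [← sr, mul_assoc, h0, mul_zero]
  have a11 : star r * star p = 0 := η.mul_eq_zero_of (opp_ne i).symm sr pl
  have a12 : star p * r = 0 := by rw [← rl, ← mul_assoc, h0', zero_mul]
  have a13 : p * r = 0 := η.mul_eq_zero_of (opp_ne i).symm h1 rl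
  constructor
  · simp only [add_mul, sub_mul, mul_add, mul_sub, a1, a2, a3, a4, a5, a6, a7, a8]
    abel
  · simp only [add_mul, sub_mul, mul_add, mul_sub, a5, a6, a8, a9, a10, a11, a12, a13]
    abel

/-- The elementary transvection of ultrashort root type `T_i(u)`, for `u ∈ Δ⁰ᵢ`. Its `β` is
`ρ(u) + π(u) - star π(u)` and the zero component of its `γ` is `u - φ(ρ(u) + π(u))`; the only other
nonzero component of `γ` is `q₋ᵢ · β = q₋ᵢ · (ρ(u) - star π(u))`. -/
def ultrashortT (i : Fin n × Bool) (u : Δ) (hu : u ∈ η.deltaZeroAt i) : OddUnitary R Δ where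
  beta := rho u + pi u - star (pi u)
  gamma := u + -phi (rho u + pi u : R) + act (η.q (opp i)) (rho u - star (pi u) : R)
  beta_mul_star := by
    simp only [star_sub, star_add, star_star]
    rw [(η.ultrashort_products hu).1, ← neg_neg (star (pi u) * (pi u : R)), ← rho_add_star]
    abel
  star_mul_beta := by
    simp only [star_sub, star_add, star_star]
    rw [(η.ultrashort_products hu).2, ← neg_neg (star (pi u) * (pi u : R)), ← rho_add_star]
    abel
  pi_gamma := by
    obtain ⟨h0, h1, h2⟩ := η.deltaZeroAt_spec hu
    simp only [pi_add, pi_act, pi_neg, pi_phi, pi_q, mul_sub, η.left_of_corner h2, η.star_right h1]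
    abel
  rho_gamma := by
    obtain ⟨h0, h1, h2⟩ := η.deltaZeroAt_spec hu
    have h3 : star (pi u) * η.e (opp i) = (0 : R) := by
      rw [← opp_opp i, ← star_e, ← star_mul, opp_opp, h0, star_zero]
    simp only [rho_add, rho_act, rho_q, pi_add, pi_act, pi_neg, pi_phi, pi_q, ← star_rho, rho_phi,
      star_sub, star_add, star_star, mul_zero, zero_mul, neg_zero, add_zero, ← mul_assoc, h3]
    abel

/-- The elementary unitary group `EU(n; R, Δ)`, generated by all elementary transvections. -/
def EU : Subgroup (OddUnitary R Δ) :=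
  Subgroup.closure
    ({g | ∃ (i j : Fin n × Bool) (hij : i ≠ j) (_ : i ≠ opp j) (x : R)
        (hx : η.e i * x * η.e j = x), g = η.shortT i j hij x hx} ∪
     {g | ∃ (i : Fin n × Bool) (u : Δ) (hu : u ∈ η.deltaZeroAt i), g = η.ultrashortT i u hu})

end OrthogonalHyperbolicFamily

/-- A finite sequence `x₁, …, x_k` in the unital ring `e R e` (`e` an idempotent) is right
unimodular: `∑ yᵢ xᵢ = e` for some `yᵢ ∈ e R e`. -/
def IsRightUnimodular {R : Type*} [NonUnitalRing R] (e : R) {k : ℕ} (x : Fin k → R) : Prop :=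
  ∃ y : Fin k → R, (∀ i, e * y i * e = y i) ∧ ∑ i, y i * x i = e

/-- The stable rank condition `sr(e R e) ≤ d` for an idempotent `e`. -/
def StableRankLE {R : Type*} [NonUnitalRing R] (e : R) (d : ℕ) : Prop :=
  ∀ x : Fin (d + 1) → R, (∀ i, e * x i * e = x i) → IsRightUnimodular e x →
    ∃ a : Fin d → R, (∀ i, e * a i * e = a i) ∧
      IsRightUnimodular e (fun i : Fin d => x i.castSucc + a i * x (Fin.last d))

namespace OrthogonalHyperbolicFamily

variable {R Δ : Type*} [NonUnitalRing R] [StarRing R] [AddGroup Δ] [OddFormRing R Δ] {n : ℕ}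
  (η : OrthogonalHyperbolicFamily R Δ n)

/-- The form parameter `Δᵉᵛ = ρ(Ker(π|_{Δ · e})) ⊆ R`, where `e = ∑_{k ≠ 0} e_k`. -/
def evenParam : Set R :=
  {a | ∃ u : Δ, pi (act u (∑ i, (η.pair i).eAbs)) = (0 : R) ∧
    rho (act u (∑ i, (η.pair i).eAbs)) = a}

/-- The condition `Λsr(η; R, Δ) ≤ d`, where `η` is the member number `i` of the family. The sequence
`x_{-k}, …, x_{-1}, x_1, …, x_k`, `k = d + 1`, is given by `xp i = x_i` and `xm i = x_{-i}`, and the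
matrix by `a i j = a_{i, -j}`. -/
def LambdaStableRankLE (i : Fin n) (d : ℕ) : Prop :=
  StableRankLE (η.pair i).ep d ∧
  ∀ xp xm : Fin (d + 1) → R,
    (∀ k, (η.pair i).ep * xp k * (η.pair i).ep = xp k) →
    (∀ k, (η.pair i).em * xm k * (η.pair i).ep = xm k) →
    (∃ yp ym : Fin (d + 1) → R,
      (∀ k, (η.pair i).ep * yp k * (η.pair i).ep = yp k) ∧
      (∀ k, (η.pair i).ep * ym k * (η.pair i).em = ym k) ∧
      ∑ k, ym k * xm k + ∑ k, yp k * xp k = (η.pair i).ep) →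
    ∃ a : Fin (d + 1) → Fin (d + 1) → R,
      (∀ k l, (η.pair i).ep * a k l * (η.pair i).em = a k l) ∧
      (∀ k l, a k l = -star (a l k)) ∧
      (∀ k, a k k ∈ η.evenParam) ∧
      IsRightUnimodular (η.pair i).ep (fun k => xp k + ∑ l, a k l * xm l)

end OrthogonalHyperbolicFamily

/-- The set `U(e, e'; R, Δ)` for hermitian idempotents `e, e' ∈ R`: pairs `(β, γ)` with
`γ ∈ Δ · e'` such that `α = β + e'` lies in `e R e'`, `star α * α = e'`, `α * star α = e`,
`π(γ) = β`, `ρ(γ) = star β * e'`. -/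
structure UnitaryBetween {R : Type*} (Δ : Type*) [NonUnitalRing R] [StarRing R] [AddGroup Δ]
    [OddFormRing R Δ] (e e' : R) where
  beta : R
  gamma : Δ
  alpha_mem : e * (beta + e') * e' = beta + e'
  star_mul : star (beta + e') * (beta + e') = e'
  mul_star : (beta + e') * star (beta + e') = e
  gamma_mem : ∃ u : Δ, act u e' = gamma
  pi_gamma : pi gamma = beta
  rho_gamma : rho gamma = star beta * e'

section Hom

variable {S Θ R Δ : Type*}
  [NonUnitalRing S] [StarRing S] [AddGroup Θ] [OddFormRing S Θ]
  [NonUnitalRing R] [StarRing R] [AddGroup Δ] [OddFormRing R Δ] {m n : ℕ}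

/-- For `i = m` and `j = n` (the last members of the families) this is the set
`Hom*(m; S, Θ; n; R, Δ)` of morphisms `f` with `U(f(e_{|m|}), e_{|n|}; R, Δ) ≠ ∅`. -/
def HomStar (ζ : OrthogonalHyperbolicFamily S Θ m) (η : OrthogonalHyperbolicFamily R Δ n)
    (i : Fin m) (j : Fin n) : Set (OddFormHom S Θ R Δ) :=
  {f | Nonempty (UnitaryBetween Δ (f.toRing (ζ.pair i).eAbs) (η.pair j).eAbs)}

/-- The set `Hom_{ij}(m; S, Θ; n; R, Δ)` of morphisms `f` with `f(e_{|i|}) = e_{|j|}`. -/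
def HomAt (ζ : OrthogonalHyperbolicFamily S Θ m) (η : OrthogonalHyperbolicFamily R Δ n)
    (i : Fin m) (j : Fin n) : Set (OddFormHom S Θ R Δ) :=
  {f | f.toRing (ζ.pair i).eAbs = (η.pair j).eAbs}

end Hom

open scoped Pointwise

/-! This is a Witt type cancellation argument. A morphism lies in `HomStar` when the hermitian
idempotent `ε = f(e_{|m|})` is isometric to the last hyperbolic plane of `R`. So it suffices that
the elementary group conjugates every such `ε` to `e_{|n|}` (`exists_conjRing_eq`). Conversely, a
unitary `g` restricts to an isometry from `e_{|n|}` onto its conjugate (`toUnitaryBetween`).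

An isometry `α` carries `q_n` and `q_{-n}` to isotropic vectors `v`, `w` in `Δ` with `star (π w) * π
v = e_n` (`exists_isotropic`). If `g` moves `π v` to `e_n` and `π w` to `e_{-n}`, then `α(g) α =
e_{|n|}`, and `ε = α * star α` is conjugated to `e_{|n|}`.

The column of `v` is unimodular, and three passes improve it. Stable rank removes the zero component
from the unimodularity relation (`exists_unimodular_hyperbolic_part`). The Λ-stable rank then
removes the negative entries (`exists_unimodular_positive_part`). Stable rank once more makes the
last positive entry the standard one (`exists_last_entry_eq`). An isotropic vector with a unit entry
is then reduced to a basis vector by explicit transvections (`exists_reduce_of_entry_eq`). After `v`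
has become standard, the preserved pairing forces the `-n` entry of the image of `w` to be `e_{-n}`.
The same reduction applies to it, by an element that fixes `e_n`. -/

namespace OddUnitary

/-! ### The isometric action of the unitary group on `Δ` -/

variable {R Δ : Type*} [NonUnitalRing R] [StarRing R] [AddGroup Δ] [OddFormRing R Δ]

/-- The left action of `U(R, Δ)` on `Δ` by isometries, `u ↦ γ(g) · π(u) + u`. -/
def vecAct (g : OddUnitary R Δ) (u : Δ) : Δ := act g.gamma (pi u : R) + u

theorem pi_vecAct (g : OddUnitary R Δ) (u : Δ) :
    (pi (g.vecAct u) : R) = pi u + g.beta * pi u := by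
  rw [vecAct, pi_add, pi_act, g.pi_gamma, add_comm]

theorem rho_vecAct (g : OddUnitary R Δ) (u : Δ) : (rho (g.vecAct u) : R) = rho u := by
  rw [vecAct, rho_add, rho_act, pi_act, g.rho_gamma, g.pi_gamma, star_mul]
  simp

theorem act_vecAct (g : OddUnitary R Δ) (u : Δ) (x : R) :
    act (g.vecAct u) x = g.vecAct (act u x) := by
  rw [vecAct, vecAct, act_add_left, pi_act, act_mul]

/-- Invariance of the pairing comes from `star α * α = 1`. It transfers a normal form of one vector
of a hyperbolic pair to information on the other. -/
theorem star_mul_pi_vecAct (g : OddUnitary R Δ) (u v : Δ) :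
    star (pi (g.vecAct u)) * (pi (g.vecAct v) : R) = star (pi u) * pi v := by
  rw [pi_vecAct, pi_vecAct]
  have h : star (pi u + g.beta * pi u) * (pi v + g.beta * pi v : R)
      = star (pi u) * pi v
        + star (pi u) * (star g.beta * g.beta + g.beta + star g.beta) * pi v := by
    rw [star_add, star_mul]; noncomm_ring
  rw [h, g.star_mul_beta, mul_zero, zero_mul, add_zero]

/-- The expression `a + β a` is `α a` with the missing unit multiplied out. The identity is
therefore `α(gh) a = α(g) (α(h) a)`, used to chain reductions of a column. -/
theorem beta_mul_vec (g h : OddUnitary R Δ) (a : R) :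
    a + (g * h).beta * a = (a + h.beta * a) + g.beta * (a + h.beta * a) := by
  rw [beta_mul]; noncomm_ring

end OddUnitary

/-- The left ideal `∑ R xᵢ`. -/
def leftSpan {R ι : Type*} [NonUnitalRing R] [Fintype ι] (x : ι → R) : AddSubgroup R where
  carrier := {r | ∃ y : ι → R, ∑ i, y i * x i = r}
  zero_mem' := ⟨0, by simp⟩
  add_mem' := by
    rintro _ _ ⟨y, rfl⟩ ⟨z, rfl⟩
    exact ⟨y + z, by simp [add_mul, Finset.sum_add_distrib]⟩
  neg_mem' := by
    rintro _ ⟨y, rfl⟩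
    exact ⟨-y, by simp⟩

section LeftSpan

variable {R ι : Type*} [NonUnitalRing R] [Fintype ι]

theorem mul_mem_leftSpan {x : ι → R} (r : R) {s : R} (hs : s ∈ leftSpan x) :
    r * s ∈ leftSpan x := by
  obtain ⟨y, rfl⟩ := hs
  exact ⟨fun i => r * y i, by simp [Finset.mul_sum, mul_assoc]⟩

theorem mul_apply_mem_leftSpan [DecidableEq ι] (x : ι → R) (r : R) (i : ι) :
    r * x i ∈ leftSpan x :=
  ⟨Pi.single i r, by
    rw [Finset.sum_eq_single i]
    · simp
    · intro j _ hj; simp [hj]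
    · simp⟩

end LeftSpan

/-! ### Products of transvections and reduction of a vector with a unit entry -/

namespace OrthogonalHyperbolicFamily

variable {R Δ : Type*} [NonUnitalRing R] [StarRing R] [AddGroup Δ] [OddFormRing R Δ] {n : ℕ}
  (η : OrthogonalHyperbolicFamily R Δ n)

theorem shortT_mem_EU {i j : Fin n × Bool} (hij : i ≠ j) (hij' : i ≠ opp j) {x : R}
    (hx : η.e i * x * η.e j = x) : η.shortT i j hij x hx ∈ η.EU :=
  Subgroup.subset_closure (Or.inl ⟨i, j, hij, hij', x, hx, rfl⟩)

theorem ultrashortT_mem_EU {i : Fin n × Bool} {u : Δ} (hu : u ∈ η.deltaZeroAt i) :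
    η.ultrashortT i u hu ∈ η.EU :=
  Subgroup.subset_closure (Or.inr ⟨i, u, hu, rfl⟩)

/-- Conjugation on `R` depends on `β` alone, so for the elementary elements constructed below only
`β` is recorded. -/
theorem exists_beta_short {i j : Fin n × Bool} (hij : i ≠ j) (hij' : i ≠ opp j) {x : R}
    (hx : η.e i * x * η.e j = x) : ∃ g ∈ η.EU, g.beta = x - star x :=
  ⟨_, η.shortT_mem_EU hij hij' hx, rfl⟩

theorem exists_beta_ultrashort {i : Fin n × Bool} {u : Δ} (h0 : ∀ k, η.e k * pi u = (0 : R))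
    (hu : act u (η.e i) = u) : ∃ g ∈ η.EU, g.beta = rho u + pi u - star (pi u : R) :=
  ⟨_, η.ultrashortT_mem_EU ⟨u, h0, hu⟩, rfl⟩

/-- Products of elementary transvections, up to an additive submonoid of error terms. -/
theorem exists_beta_sum {ι : Type*} (Q : AddSubmonoid R) (b : ι → R) (s : Finset ι)
    (h : ∀ i ∈ s, ∃ g ∈ η.EU, (∃ r ∈ Q, g.beta = b i + r) ∧
      (∀ j ∈ s, j ≠ i → b j * g.beta ∈ Q) ∧ ∀ r ∈ Q, r * g.beta ∈ Q) :
    ∃ g ∈ η.EU, ∃ r ∈ Q, g.beta = ∑ i ∈ s, b i + r := by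
  classical
  induction s using Finset.induction_on with
  | empty => exact ⟨1, one_mem _, 0, zero_mem _, by simp⟩
  | insert i s hi ih =>
    obtain ⟨g, hg, r, hr, hgr⟩ := ih fun j hj => by
      obtain ⟨g, hg, h1, h2, h3⟩ := h j (Finset.mem_insert_of_mem hj)
      exact ⟨g, hg, h1, fun l hl => h2 l (Finset.mem_insert_of_mem hl), h3⟩
    obtain ⟨g', hg', ⟨r', hr', hgr'⟩, h2, h3⟩ := h i (Finset.mem_insert_self _ _)
    -- The cross term `β(g) β(g')` splits into the products `b j * β(g')` and `r * β(g')`, which the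
    -- hypotheses place in `Q`.
    refine ⟨g * g', mul_mem hg hg', (∑ j ∈ s, b j * g'.beta) + r * g'.beta + (r + r'), ?_, ?_⟩
    · refine add_mem (add_mem (sum_mem fun j hj => ?_) (h3 r hr)) (add_mem hr hr')
      exact h2 j (Finset.mem_insert_of_mem hj) fun hji => hi (hji ▸ hj)
    · rw [OddUnitary.beta_mul, Finset.sum_insert hi, ← Finset.sum_mul, hgr, add_mul]
      nth_rw 3 [hgr']
      abel

theorem act_q (k : Fin n × Bool) : act (η.q k) (η.e k) = η.q k := by
  obtain ⟨i, b⟩ := k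
  cases b <;> simp [e, q, (η.pair i).act_qp, (η.pair i).act_qm]

/-- Clearing of the entries `e_i π(v)`, `i ≠ ±k`, of a vector whose `k`-th entry is `1`. -/
theorem exists_clear_entries {k : Fin n × Bool} {a : R} (ha : a * η.e k = a)
    (hk : η.e k * a = η.e k) :
    ∃ g ∈ η.EU, (∀ i, i ≠ k → i ≠ opp k → η.e i * (a + g.beta * a) = 0) ∧
      η.e k * (a + g.beta * a) = η.e k ∧ g.beta * η.e (opp k) = 0 := by
  classical
  -- `Q` is `e_{-k} R e_k`. The cross terms `star (x j) * x i` land there and affect only the entry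
  -- `-k`, which is left for the ultrashort transvection.
  let Q : AddSubmonoid R :=
    { carrier := {r | η.e (opp k) * r = r ∧ r * η.e k = r}
      zero_mem' := by simp
      add_mem' := fun {x y} hx hy => ⟨by rw [mul_add, hx.1, hy.1], by rw [add_mul, hx.2, hy.2]⟩ }
  have hQ : ∀ r, r ∈ Q ↔ η.e (opp k) * r = r ∧ r * η.e k = r := fun r => Iff.rfl
  -- Since the `k`-th entry is `e_k`, the transvection `T_{ik}(x i)` adds `x i` to the `i`-th entry,
  -- hence the choice of minus that entry.
  let x : Fin n × Bool → R := fun i => -(η.e i * a)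
  have hx : ∀ i, η.e i * x i * η.e k = x i := fun i => by
    simp only [x, mul_neg, neg_mul, mul_assoc, ha]
    rw [← mul_assoc, e_mul_self]
  have xl := fun i => η.left_of_corner (hx i)
  have xr := fun i => η.right_of_corner (hx i)
  have sl := fun i => η.star_left (xl i)
  have sr := fun i => η.star_right (xr i)
  obtain ⟨g, hg, r, hr, hgr⟩ := η.exists_beta_sum Q (fun i => x i - star (x i))
    (Finset.univ.filter fun i => i ≠ k ∧ i ≠ opp k) (by
      intro i hi
      obtain ⟨-, hik, hik'⟩ := Finset.mem_filter.mp hi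
      obtain ⟨g, hg, hb⟩ := η.exists_beta_short hik hik' (hx i)
      refine ⟨g, hg, ⟨0, zero_mem _, by rw [hb, add_zero]⟩, fun j hj hji => ?_, fun r hr => ?_⟩
      · obtain ⟨-, hjk, hjk'⟩ := Finset.mem_filter.mp hj
        have h1 : x j * x i = 0 := η.mul_eq_zero_of hik.symm (xr j) (xl i)
        have h2 : x j * star (x i) = 0 := η.mul_eq_zero_of (opp_ne k).symm (xr j) (sr i)
        have h3 : star (x j) * star (x i) = 0 :=
          η.mul_eq_zero_of (opp_ne_opp hjk) (sl j) (sr i)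
        have e : (x j - star (x j)) * g.beta = -(star (x j) * x i) := by
          rw [hb, sub_mul, mul_sub, mul_sub, h1, h2, h3]; abel
        rw [e, hQ]
        constructor
        · rw [mul_neg, ← mul_assoc, sr]
        · rw [neg_mul, mul_assoc, xr]
      · rw [hb, mul_sub, η.mul_eq_zero_of hik.symm hr.2 (xl i),
          η.mul_eq_zero_of (opp_ne k).symm hr.2 (sr i), sub_zero]
        exact zero_mem _)
  have hxa : ∀ i, x i * a = x i := fun i => by rw [← xr i, mul_assoc, hk]
  have hra : r * a = r := by rw [← hr.2, mul_assoc, hk]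
  have hmul : ∀ i, i ≠ opp k → η.e i * (a + g.beta * a)
      = η.e i * a + ∑ j with j ≠ k ∧ j ≠ opp k, η.e i * x j := fun i hi => by
    have h1 : η.e i * r = 0 := η.mul_eq_zero_of hi (η.e_mul_self i) hr.1
    have h2 : ∀ j, η.e i * star (x j) = 0 := fun j =>
      η.mul_eq_zero_of hi (η.e_mul_self i) (sr j)
    rw [hgr, mul_add, ← mul_assoc, mul_add, h1, add_zero, Finset.mul_sum, Finset.sum_mul]
    congr 1
    refine Finset.sum_congr rfl fun j _ => ?_
    rw [mul_sub, h2, sub_zero, mul_assoc, hxa]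
  refine ⟨g, hg, fun i hi hi' => ?_, ?_, ?_⟩
  · rw [hmul i hi', Finset.sum_eq_single i]
    · rw [xl]; simp [x]
    · intro j _ hj
      exact η.mul_eq_zero_of hj.symm (η.e_mul_self i) (xl j)
    · intro h; exact absurd (Finset.mem_filter.mpr ⟨Finset.mem_univ _, hi, hi'⟩) h
  · rw [hmul k (opp_ne k).symm, hk, Finset.sum_eq_zero, add_zero]
    intro j hj
    exact η.mul_eq_zero_of (Finset.mem_filter.mp hj).2.1.symm (η.e_mul_self k) (xl j)
  · rw [hgr, add_mul, η.mul_eq_zero_of (opp_ne k).symm hr.2 (η.e_mul_self _), add_zero,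
      Finset.sum_mul]
    refine Finset.sum_eq_zero fun j hj => ?_
    rw [sub_mul, η.mul_eq_zero_of (opp_ne k).symm (xr j) (η.e_mul_self _),
      η.mul_eq_zero_of (opp_ne_opp (Finset.mem_filter.mp hj).2.1) (sl j) (η.e_mul_self _), sub_zero]

/-- An isotropic vector whose `k`-th entry is `1` is moved to `e_k` by an elementary element
fixing `e_{-k}`. -/
theorem exists_reduce_of_entry_eq {k : Fin n × Bool} {v : Δ} (hv : act v (η.e k) = v)
    (hρ : rho v = (0 : R)) (hk : η.e k * pi v = η.e k) :
    ∃ g ∈ η.EU, (pi v + g.beta * pi v : R) = η.e k ∧ g.beta * η.e (opp k) = 0 := by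
  have hvk : pi v * η.e k = (pi v : R) := by rw [← pi_act, hv]
  obtain ⟨g, hg, h0, hgk, hgo⟩ := η.exists_clear_entries hvk hk
  rw [← OddUnitary.pi_vecAct] at hgk
  have h0' : ∀ i, i ≠ k → i ≠ opp k → η.e i * (pi (g.vecAct v) : R) = 0 := by
    intro i hi hi'; rw [OddUnitary.pi_vecAct]; exact h0 i hi hi'
  have hv' : act (g.vecAct v) (η.e k) = g.vecAct v := by rw [OddUnitary.act_vecAct, hv]
  have hρ' : rho (g.vecAct v) = (0 : R) := by rw [OddUnitary.rho_vecAct, hρ]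
  have hπ := g.pi_vecAct v
  generalize g.vecAct v = w at *
  clear h0
  generalize hwa : (pi w : R) = a at *
  have hak : a * η.e k = a := by rw [← hwa, ← pi_act, hv']
  have hsa : star a * η.e (opp k) = η.e (opp k) := by
    rw [← η.star_e, ← star_mul, hgk]
  set c := η.e (opp k) * a with hc
  have hc1 : η.e (opp k) * c = c := by rw [hc, ← mul_assoc, e_mul_self]
  have hc2 : c * η.e k = c := by rw [hc, mul_assoc, hak]
  have hsc1 : star c * η.e k = star c := by
    have := η.star_left hc1; rwa [opp_opp] at this
  have hsc2 : star a * η.e k = star c := by rw [hc, star_mul, star_e, opp_opp]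
  have hsac : star a * c = c := by rw [← hc1, ← mul_assoc, hsa]
  -- Only the entries `k` and `-k` and the zero component remain. Removing the two entries inside
  -- `Δ` leaves the zero component `w0`, and isotropy of `w` forces `ρ(w0) = c`.
  set w0 := w + -act (η.q (opp k)) c + -η.q k with hw0
  have hp : (pi w0 : R) = a - c - η.e k := by
    simp only [hw0, pi_add, pi_neg, pi_act, pi_q, hwa, hc1]; abel
  have hr : (rho w0 : R) = c := by
    simp only [hw0, rho_add, pi_add, pi_neg, pi_act, pi_q, hwa, hc1, ← star_rho, rho_act, rho_q,
      hρ', mul_zero, zero_mul, star_zero, star_add, star_neg, mul_neg, neg_mul, add_mul, hsac,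
      hsc1, hsc2]
    abel
  have hw0k : act w0 (η.e k) = w0 := by
    simp only [hw0, act_add_left, act_neg_left, hv', act_q, ← act_mul, hc2]
  have hp0 : ∀ i, η.e i * (pi w0 : R) = 0 := fun i => by
    rw [hp, mul_sub, mul_sub]
    by_cases h1 : i = k
    · subst h1
      rw [hgk, e_mul_self, η.mul_eq_zero_of (opp_ne i).symm (η.e_mul_self i) hc1]; abel
    by_cases h2 : i = opp k
    · subst h2
      rw [← hc, hc1, η.e_mul_e (opp_ne k)]; abel
    · rw [h0' i h1 h2, η.e_mul_e h1, η.mul_eq_zero_of h2 (η.e_mul_self i) hc1]; abel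
  have hpk : pi w0 * η.e k = (pi w0 : R) := by rw [← pi_act, hw0k]
  have hsum := rho_add_star (R := R) w0
  -- With `p = π(w0)`, the transvection `T_k(-w0)` has `β = star c - p + star p`. On `e_k + c + p`
  -- it produces `e_k + c + star c + star p * p`, and the last three terms cancel by `rho_add_star`.
  obtain ⟨g', hg', hb⟩ := η.exists_beta_ultrashort (i := k) (u := -w0)
    (fun i => by rw [pi_neg, mul_neg, hp0, neg_zero]) (by rw [act_neg_left, hw0k])
  rw [← star_rho, hr, pi_neg, star_neg] at hb
  rw [hr] at hsum
  generalize (pi w0 : R) = p at *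
  have hsp : ∀ i, star p * η.e i = 0 := fun i => by
    rw [← opp_opp i, ← star_e, ← star_mul, hp0, star_zero]
  have ha : a = η.e k + c + p := by rw [hp]; abel
  refine ⟨g' * g, mul_mem hg' hg, ?_, ?_⟩
  · rw [OddUnitary.beta_mul_vec, ← hπ, hb]
    have h1 : star c * a = star c := by rw [← hsc1, mul_assoc, hgk]
    have h2 : p * a = p := by rw [← hpk, mul_assoc, hgk]
    have h3 : star p * a = star p * p := by
      have h4 : star p * c = 0 := by rw [← hc1, ← mul_assoc, hsp, zero_mul]
      rw [ha, mul_add, mul_add, hsp, h4]; abel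
    have h5 : star p * p = -(c + star c) := by rw [hsum, neg_neg]
    rw [sub_neg_eq_add, add_mul, add_mul, neg_mul, h1, h2, h3, h5]
    nth_rw 1 [ha]
    abel
  · have h1 : p * η.e (opp k) = 0 := η.mul_eq_zero_of (opp_ne k).symm hpk (η.e_mul_self _)
    have h2 : star c * η.e (opp k) = 0 :=
      η.mul_eq_zero_of (opp_ne k).symm hsc1 (η.e_mul_self _)
    rw [OddUnitary.beta_mul, add_mul, add_mul, mul_assoc, hgo, mul_zero, hb, sub_neg_eq_add, add_mul,
      add_mul, neg_mul, h1, h2, hsp]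
    abel

end OrthogonalHyperbolicFamily

/-! ### Unipotent blocks, columns and rows of transvections -/

namespace OrthogonalHyperbolicFamily

variable {R Δ : Type*} [NonUnitalRing R] [StarRing R] [AddGroup Δ] [OddFormRing R Δ] {n : ℕ}
  (η : OrthogonalHyperbolicFamily R Δ n)

/-- The idempotent `∑ e_{-i}`, `1 ≤ i ≤ n`. -/
def eNeg : R := ∑ i, η.e (i, false)

theorem e_neg_mul_eNeg (i : Fin n) : η.e (i, false) * η.eNeg = η.e (i, false) := by
  rw [eNeg, Finset.mul_sum, Finset.sum_eq_single i, e_mul_self]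
  · intro j _ hj; exact η.e_mul_e (by simpa using hj.symm)
  · simp

theorem eNeg_mul_e_pos (i : Fin n) : η.eNeg * η.e (i, true) = 0 := by
  rw [eNeg, Finset.sum_mul]
  exact Finset.sum_eq_zero fun j _ => η.e_mul_e (by simp)

/-- The unipotent radical acts on the zero component by arbitrary liftable covectors. -/
theorem exists_beta_sum_zero {ι : Type*} (s : Finset ι) (f : ι → Fin n) (u : ι → Δ)
    (h0 : ∀ i k, η.e k * pi (u i) = (0 : R)) (hu : ∀ i, act (u i) (η.e (f i, false)) = u i) :
    ∃ g ∈ η.EU, ∃ r : R, r * η.eNeg = r ∧ η.eNeg * r = 0 ∧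
      g.beta = ∑ i ∈ s, -star (pi (u i)) + r := by
  -- Elements of `Q` read only the negative entries of a column and do not change them. The terms
  -- `ρ(u i)`, `π(u i)` and the cross terms are of this kind; only `-star (π (u i))`, from the zero
  -- component to positive entries, needs exact control.
  let Q : AddSubmonoid R :=
    { carrier := {r | r * η.eNeg = r ∧ η.eNeg * r = 0}
      zero_mem' := by simp
      add_mem' := fun {x y} hx hy =>
        ⟨by rw [add_mul, hx.1, hy.1], by rw [mul_add, hx.2, hy.2, add_zero]⟩ }
  have hpr : ∀ i, pi (u i) * η.e (f i, false) = (pi (u i) : R) := fun i => by rw [← pi_act, hu]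
  have hpn : ∀ i, pi (u i) * η.eNeg = (pi (u i) : R) := fun i => by
    rw [← hpr, mul_assoc, e_neg_mul_eNeg]
  have hnp : ∀ i, η.eNeg * pi (u i) = (0 : R) := fun i => by
    rw [eNeg, Finset.sum_mul]; exact Finset.sum_eq_zero fun j _ => h0 i _
  have hrr : ∀ i, rho (u i) * η.eNeg = (rho (u i) : R) := fun i => by
    rw [← hu, rho_act, mul_assoc, e_neg_mul_eNeg]
  have hrl : ∀ i, η.e (f i, true) * rho (u i) = (rho (u i) : R) := fun i => by
    rw [← hu, rho_act, star_e, mul_assoc, ← mul_assoc, opp, Bool.not_false, e_mul_self]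
  have hnr : ∀ i, η.eNeg * rho (u i) = (0 : R) := fun i => by
    rw [← hrl, ← mul_assoc, eNeg_mul_e_pos, zero_mul]
  have hsl : ∀ i, η.e (f i, true) * star (pi (u i)) = star (pi (u i) : R) := fun i =>
    η.star_right (hpr i)
  have hns : ∀ i, η.eNeg * star (pi (u i)) = (0 : R) := fun i => by
    rw [← hsl, ← mul_assoc, eNeg_mul_e_pos, zero_mul]
  have hse : ∀ i k, star (pi (u i)) * η.e k = (0 : R) := fun i k => by
    rw [← opp_opp k, ← star_e, ← star_mul, h0, star_zero]
  have key : ∃ g ∈ η.EU, ∃ r ∈ Q, g.beta = ∑ i ∈ s, -star (pi (u i)) + r := by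
    refine η.exists_beta_sum Q _ s fun i _ => ?_
    obtain ⟨g, hg, hb⟩ := η.exists_beta_ultrashort (h0 i) (hu i)
    refine ⟨g, hg, ⟨rho (u i) + pi (u i), ⟨?_, ?_⟩, by rw [hb]; abel⟩, fun j _ _ => ⟨?_, ?_⟩,
      fun r hr => ?_⟩
    · rw [add_mul, hrr, hpn]
    · rw [mul_add, hnr, hnp, add_zero]
    · have h1 : star (pi (u j)) * rho (u i) = (0 : R) := by rw [← hrl, ← mul_assoc, hse, zero_mul]
      have h2 : star (pi (u j)) * star (pi (u i)) = (0 : R) := by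
        rw [← hsl i, ← mul_assoc, hse, zero_mul]
      rw [hb, neg_mul, mul_sub, mul_add, h1, h2, zero_add, sub_zero, neg_mul, mul_assoc, hpn]
    · rw [← mul_assoc, mul_neg, hns, neg_zero, zero_mul]
    · have : r * g.beta = 0 := by
        rw [← hr.1, mul_assoc, hb, mul_sub, mul_add, hnr, hnp, hns]; simp
      rw [this]; exact zero_mem _
  obtain ⟨g, hg, r, hr, hgr⟩ := key
  exact ⟨g, hg, r, hr.1, hr.2, hgr⟩

/-- A vector minus its entries with nonzero indices lies in `Δ⁰`. -/
theorem exists_zero_part (v : Δ) :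
    ∃ z : Δ, pi z = (pi v - ∑ k, η.e k * pi v : R) ∧ ∀ k, η.e k * pi z = (0 : R) := by
  classical
  have h : ∀ s : Finset (Fin n × Bool), ∃ z : Δ, pi z = (pi v - ∑ k ∈ s, η.e k * pi v : R) := by
    intro s
    induction s using Finset.induction_on with
    | empty => exact ⟨v, by simp⟩
    | insert k s hk ih =>
      obtain ⟨z, hz⟩ := ih
      -- The entry `e_k π(v)` lifts to `q_k · π(v)`, so it can be removed within `Δ`; ultrashort
      -- transvections require parameters there, not merely in `R`.
      refine ⟨z + -act (η.q k) (pi v : R), ?_⟩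
      rw [pi_add, pi_neg, pi_act, pi_q, hz, Finset.sum_insert hk]; abel
  obtain ⟨z, hz⟩ := h Finset.univ
  refine ⟨z, hz, fun k => ?_⟩
  rw [hz, mul_sub, Finset.mul_sum, Finset.sum_eq_single k, ← mul_assoc, e_mul_self, sub_self]
  · intro j _ hj; rw [← mul_assoc, η.e_mul_e hj.symm, zero_mul]
  · simp

/-- Hermitian block transvections `e₊ R e₋`, elementary under the form parameter condition. -/
theorem exists_beta_block (M : Fin n → Fin n → R)
    (hM : ∀ i j, η.e (i, true) * M i j * η.e (j, false) = M i j)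
    (hstar : ∀ i j, M j i = -star (M i j))
    (hdiag : ∀ i, ∃ u : Δ, pi u = (0 : R) ∧ act u (η.e (i, false)) = u ∧ rho u = M i i) :
    ∃ g ∈ η.EU, g.beta = ∑ i, ∑ j, M i j := by
  classical
  -- Products of two elements of `K` vanish, so on the corresponding group elements `β` turns
  -- products into sums.
  let K : AddSubmonoid R :=
    { carrier := {b | η.eNeg * b = 0 ∧ b * η.eNeg = b ∧ ∃ g ∈ η.EU, g.beta = b}
      zero_mem' := ⟨by simp, by simp, 1, one_mem _, rfl⟩
      add_mem' := by
        rintro x y ⟨hx, hx', g, hg, rfl⟩ ⟨hy, hy', h, hh, rfl⟩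
        refine ⟨by rw [mul_add, hx, hy, add_zero], by rw [add_mul, hx', hy'],
          g * h, mul_mem hg hh, ?_⟩
        rw [OddUnitary.beta_mul]
        nth_rw 1 [← hx']
        rw [mul_assoc, hy, mul_zero, zero_add] }
  have hl : ∀ i j, η.eNeg * M i j = 0 := fun i j => by
    rw [← η.left_of_corner (hM i j), ← mul_assoc, eNeg_mul_e_pos, zero_mul]
  have hr : ∀ i j, M i j * η.eNeg = M i j := fun i j => by
    rw [← η.right_of_corner (hM i j), mul_assoc, e_neg_mul_eNeg]
  have hd : ∀ i, M i i ∈ K := fun i => by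
    refine ⟨hl _ _, hr _ _, ?_⟩
    obtain ⟨u, h0, hu, hρ⟩ := hdiag i
    obtain ⟨g, hg, hb⟩ := η.exists_beta_ultrashort (fun k => by rw [h0, mul_zero]) hu
    exact ⟨g, hg, by rw [hb, h0, hρ]; simp⟩
  have ho : ∀ i j, i ≠ j → M i j + M j i ∈ K := fun i j hij => by
    refine ⟨by rw [mul_add, hl, hl, add_zero], by rw [add_mul, hr, hr], ?_⟩
    obtain ⟨g, hg, hb⟩ := η.exists_beta_short (i := (i, true)) (j := (j, false)) (by simp)
      (by simpa [opp] using hij) (hM i j)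
    exact ⟨g, hg, by rw [hb, hstar i j, sub_eq_add_neg]⟩
  have h : ∀ s : Finset (Fin n), ∑ i ∈ s, ∑ j ∈ s, M i j ∈ K := by
    intro s
    induction s using Finset.induction_on with
    | empty => simp
    | insert k s hk ih =>
      -- Adding an index contributes one diagonal entry, which is ultrashort, and pairs `M i k + M k
      -- i`, each the `β` of one short transvection.
      have e : ∑ i ∈ insert k s, ∑ j ∈ insert k s, M i j
          = M k k + ∑ i ∈ s, (M i k + M k i) + ∑ i ∈ s, ∑ j ∈ s, M i j := by
        simp only [Finset.sum_insert hk, Finset.sum_add_distrib]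
        abel
      rw [e]
      exact add_mem (add_mem (hd k) (sum_mem fun i hi => ho i k fun h => hk (h ▸ hi))) ih
  exact (h Finset.univ).2.2

/-- Transvections in one column. -/
theorem exists_beta_column {ι : Type*} (s : Finset ι) (f : ι → Fin n) (l : Fin n) (x : ι → R)
    (hf : ∀ i, f i ≠ l) (hx : ∀ i, η.e (f i, true) * x i * η.e (l, true) = x i) :
    ∃ g ∈ η.EU, g.beta = ∑ i ∈ s, (x i - star (x i)) := by
  have xl := fun i => η.left_of_corner (hx i)
  have xr := fun i => η.right_of_corner (hx i)
  have sl := fun i => η.star_left (xl i)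
  have sr := fun i => η.star_right (xr i)
  -- All products of the summands vanish, including those with `f i = f j`, so there is no error
  -- term.
  have key : ∃ g ∈ η.EU, ∃ r ∈ (⊥ : AddSubmonoid R),
      g.beta = ∑ i ∈ s, (x i - star (x i)) + r := by
    refine η.exists_beta_sum ⊥ _ s fun i _ => ?_
    obtain ⟨g, hg, hb⟩ := η.exists_beta_short (by simpa using hf i) (by simp [opp]) (hx i)
    refine ⟨g, hg, ⟨0, rfl, by rw [hb, add_zero]⟩, fun j _ _ => ?_, fun r hr => ?_⟩
    · have h1 : x j * x i = 0 := η.mul_eq_zero_of (by simpa using (hf i).symm) (xr j) (xl i)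
      have h2 : x j * star (x i) = 0 := η.mul_eq_zero_of (opp_ne _).symm (xr j) (sr i)
      have h3 : star (x j) * star (x i) = 0 :=
        η.mul_eq_zero_of (by simpa [opp] using hf j) (sl j) (sr i)
      have h4 : star (x j) * x i = 0 := η.mul_eq_zero_of (by simp [opp]) (sl j) (xl i)
      rw [hb, sub_mul, mul_sub, mul_sub, h1, h2, h3, h4]; simp
    · rw [AddSubmonoid.mem_bot.mp hr, zero_mul]; exact zero_mem _
  obtain ⟨g, hg, r, hr, hb⟩ := key
  exact ⟨g, hg, by rw [hb, AddSubmonoid.mem_bot.mp hr, add_zero]⟩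

/-- Transvections in one row. -/
theorem exists_beta_row {ι : Type*} (s : Finset ι) (f : ι → Fin n) (l : Fin n) (x : ι → R)
    (hf : ∀ i, f i ≠ l) (hx : ∀ i, η.e (l, true) * x i * η.e (f i, true) = x i) :
    ∃ g ∈ η.EU, g.beta = ∑ i ∈ s, (x i - star (x i)) := by
  have xl := fun i => η.left_of_corner (hx i)
  have xr := fun i => η.right_of_corner (hx i)
  have sl := fun i => η.star_left (xl i)
  have sr := fun i => η.star_right (xr i)
  have key : ∃ g ∈ η.EU, ∃ r ∈ (⊥ : AddSubmonoid R),
      g.beta = ∑ i ∈ s, (x i - star (x i)) + r := by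
    refine η.exists_beta_sum ⊥ _ s fun i _ => ?_
    obtain ⟨g, hg, hb⟩ := η.exists_beta_short (by simpa using (hf i).symm) (by simp [opp]) (hx i)
    refine ⟨g, hg, ⟨0, rfl, by rw [hb, add_zero]⟩, fun j _ _ => ?_, fun r hr => ?_⟩
    · have h1 : x j * x i = 0 := η.mul_eq_zero_of (by simpa using hf j) (xr j) (xl i)
      have h2 : x j * star (x i) = 0 := η.mul_eq_zero_of (by simp [opp]) (xr j) (sr i)
      have h3 : star (x j) * star (x i) = 0 :=
        η.mul_eq_zero_of (by simpa [opp] using (hf i).symm) (sl j) (sr i)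
      have h4 : star (x j) * x i = 0 := η.mul_eq_zero_of (by simp [opp]) (sl j) (xl i)
      rw [hb, sub_mul, mul_sub, mul_sub, h1, h2, h3, h4]; simp
    · rw [AddSubmonoid.mem_bot.mp hr, zero_mul]; exact zero_mem _
  obtain ⟨g, hg, r, hr, hb⟩ := key
  exact ⟨g, hg, by rw [hb, AddSubmonoid.mem_bot.mp hr, add_zero]⟩

end OrthogonalHyperbolicFamily

theorem add_mul_mul_of_mul_eq {R : Type*} [NonUnitalRing R] {a e : R} (ha : a * e = a) (b : R) :
    (a + b * a) * e = a + b * a := by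
  rw [add_mul, mul_assoc, ha]

namespace OrthogonalHyperbolicFamily

/-! ### Matrix units of a free family -/

section MatrixUnits

variable {R Δ : Type*} [NonUnitalRing R] [StarRing R] [AddGroup Δ] [OddFormRing R Δ] {n : ℕ}
  (η : OrthogonalHyperbolicFamily R Δ n)

/-- A system of matrix units `E i j ∈ e_i R e_j` for a free family. -/
structure MatrixUnits where
  E : Fin n → Fin n → R
  diag : ∀ i, E i i = η.e (i, true)
  mul : ∀ i j k, E i j * E j k = E i k

variable {η} (M : η.MatrixUnits)

theorem IsFree.nonempty_matrixUnits (h : η.IsFree) : Nonempty η.MatrixUnits := by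
  obtain ⟨E, h1, h2, -⟩ := h
  exact ⟨⟨E, h1, h2⟩⟩

namespace MatrixUnits

theorem e_mul (i j : Fin n) : η.e (i, true) * M.E i j = M.E i j := by rw [← M.diag, M.mul]

theorem mul_e (i j : Fin n) : M.E i j * η.e (j, true) = M.E i j := by rw [← M.diag, M.mul]

theorem star_mul_e (i j : Fin n) : star (M.E i j) * η.e (i, false) = star (M.E i j) :=
  η.star_left (M.e_mul i j)

theorem e_mul_star (i j : Fin n) : η.e (j, false) * star (M.E i j) = star (M.E i j) :=
  η.star_right (M.mul_e i j)

theorem star_mul_star (i j k : Fin n) : star (M.E j k) * star (M.E i j) = star (M.E i k) := by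
  rw [← star_mul, M.mul]

theorem star_diag (i : Fin n) : star (M.E i i) = η.e (i, false) := by
  rw [M.diag, star_e]; rfl

theorem mul_eq_zero {i j k l : Fin n} (h : j ≠ k) : M.E i j * M.E k l = 0 :=
  η.mul_eq_zero_of (by simpa using h) (M.mul_e i j) (M.e_mul k l)

end MatrixUnits

end MatrixUnits

/-! ### Stable rank reductions of a unimodular column -/

section Rank

variable {R Δ : Type*} [NonUnitalRing R] [StarRing R] [AddGroup Δ] [OddFormRing R Δ] {d : ℕ}
  {η : OrthogonalHyperbolicFamily R Δ (d + 1)} (o : Fin (d + 1))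

/-- Under the stable rank condition, the hyperbolic part of a unimodular vector can be made
unimodular. -/
theorem exists_unimodular_hyperbolic_part (M : η.MatrixUnits) (hsr : StableRankLE (η.e (o, true)) d) {a : R}
    (ha : a * η.e (o, true) = a) {w : Δ} (hw : star (pi w) * a = η.e (o, true)) :
    ∃ g ∈ η.EU, η.e (o, true) ∈ leftSpan fun k => η.e k * (a + g.beta * a) := by
  classical
  obtain ⟨z, hz, hz0⟩ := η.exists_zero_part w
  set s : R := star (pi w) with hs
  set p : R := pi z with hp
  set e₁ := η.e (o, true) with he₁
  have he : e₁ * e₁ = e₁ := η.e_mul_self _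
  -- `T` gathers the contributions of the negative entries and of the last positive entry. Setting
  -- the latter aside leaves `d` positive entries and one remainder, exactly the `d + 1` terms that
  -- stable rank at most `d` can shorten.
  let T : R := ∑ j, s * η.e (j, false) * a + s * η.e (Fin.last d, true) * a
  have hdecomp : e₁ = star p * a + (∑ i : Fin d, s * η.e (i.castSucc, true) * a + T) := by
    have h1 : star p = s - ∑ k, s * η.e k := by
      rw [hz, star_sub, star_sum, ← hs]
      congr 1
      -- Reindexing by `k ↦ -k` is needed because `star e_k = e_{-k}`.
      rw [← Equiv.sum_comp (Function.Involutive.toPerm opp (opp_opp (n := d + 1)))]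
      refine Finset.sum_congr rfl fun k _ => ?_
      rw [star_mul, star_e, ← hs]
      exact congrArg (fun j => s * η.e j) (opp_opp k)
    have h2 : ∑ k, s * η.e k = ∑ j, s * η.e (j, false)
        + (∑ i : Fin d, s * η.e (i.castSucc, true) + s * η.e (Fin.last d, true)) := by
      rw [Fintype.sum_prod_type, ← Fin.sum_univ_castSucc (fun i => s * η.e (i, true)),
        ← Finset.sum_add_distrib]
      refine Finset.sum_congr rfl fun j _ => ?_
      rw [Fintype.sum_bool, add_comm]
    have h3 : s = star p + ∑ k, s * η.e k := by rw [h1]; abel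
    nth_rw 1 [← hw, h3, h2]
    simp only [T, add_mul, Finset.sum_mul]
    abel
  -- The remainder is defined as a difference, so that unimodularity of the sequence is immediate;
  -- `hc1` identifies it with `e₁ (star p * a + T)`.
  set c := e₁ - ∑ i : Fin d, e₁ * s * M.E i.castSucc o * (M.E o i.castSucc * a) with hc
  have hc1 : c = e₁ * (star p * a) + e₁ * T := by
    have h : ∑ i : Fin d, e₁ * s * M.E i.castSucc o * (M.E o i.castSucc * a)
        = e₁ * ∑ i : Fin d, s * η.e (i.castSucc, true) * a := by
      rw [Finset.mul_sum]
      refine Finset.sum_congr rfl fun i _ => ?_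
      rw [← M.diag i.castSucc, ← M.mul i.castSucc o i.castSucc]
      simp only [mul_assoc]
    rw [hc, h]
    nth_rw 1 [← he]
    nth_rw 2 [hdecomp]
    rw [mul_add, mul_add]
    abel
  have hcc : e₁ * c * e₁ = c := by
    have h1 : e₁ * c = c := by rw [hc1, ← mul_add, ← mul_assoc, he]
    have h2 : c * e₁ = c := by
      rw [hc, sub_mul, he, Finset.sum_mul]
      simp only [mul_assoc, ha]
    rw [h1, h2]
  let x : Fin (d + 1) → R := Fin.snoc (fun i => M.E o i.castSucc * a) c
  have hx1 : ∀ i : Fin d, x i.castSucc = M.E o i.castSucc * a := fun i => by simp [x]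
  have hx2 : x (Fin.last d) = c := by simp [x]
  obtain ⟨b, hb, Y, -, hY⟩ := hsr x (fun i => by
      refine Fin.lastCases ?_ (fun i => ?_) i
      · rw [hx2, hcc]
      · rw [hx1, mul_assoc, mul_assoc, ha, ← mul_assoc, M.e_mul]) (by
      refine ⟨Fin.snoc (fun i => e₁ * s * M.E i.castSucc o) e₁, fun i => ?_, ?_⟩
      · refine Fin.lastCases ?_ (fun i => ?_) i
        · simp [he]
        · simp only [Fin.snoc_castSucc, mul_assoc]
          rw [← mul_assoc e₁ e₁, he, he₁, M.mul_e]
      · rw [Fin.sum_univ_castSucc]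
        simp only [Fin.snoc_castSucc, Fin.snoc_last, hx1, hx2]
        have : e₁ * c = c := by rw [← hcc, ← mul_assoc, ← mul_assoc, he]
        rw [this, hc]; abel)
  have hb1 : ∀ i, e₁ * b i = b i := fun i => η.left_of_corner (hb i)
  have hb2 : ∀ i, b i * e₁ = b i := fun i => η.right_of_corner (hb i)
  -- The vector `z · star (-t i)` makes `t i * star p` appear in `β`. This adds `b i * star p * a`
  -- to the `i`-th entry transported to index `o`.
  let t : Fin d → R := fun i => M.E i.castSucc o * b i
  have ht : ∀ i, η.e (i.castSucc, true) * t i = t i := fun i => by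
    simp only [t, ← mul_assoc, M.e_mul]
  obtain ⟨g, hg, r, hr1, hr2, hgb⟩ := η.exists_beta_sum_zero (Finset.univ : Finset (Fin d))
    Fin.castSucc (fun i => act z (star (-t i)))
    (fun i k => by rw [pi_act, ← mul_assoc, ← hp, hz0, zero_mul])
    (fun i => by
      rw [← act_mul]
      congr 1
      exact η.star_left (k := (i.castSucc, true)) (by rw [mul_neg, ht]))
  have hgb' : g.beta = ∑ i, t i * star p + r := by
    rw [hgb]
    congr 1
    refine Finset.sum_congr rfl fun i _ => ?_
    rw [pi_act, star_mul, star_star, neg_mul, neg_neg]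
  refine ⟨g, hg, ?_⟩
  set a' := a + g.beta * a with ha'
  set S := leftSpan fun k => η.e k * a' with hS
  have hSm : ∀ y k, y * (η.e k * a') ∈ S := fun y k =>
    mul_apply_mem_leftSpan (fun k => η.e k * a') y k
  have hg0 : ∀ y i j, i ≠ Fin.castSucc j → y * η.e (i, true) = y → y * t j = 0 := fun y i j hij hy =>
    η.mul_eq_zero_of (by simpa using hij) hy (ht j)
  have hneg : ∀ j, η.e (j, false) * a' = η.e (j, false) * a := fun j => by
    have h1 : η.e (j, false) * r = 0 := by rw [← e_neg_mul_eNeg, mul_assoc, hr2, mul_zero]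
    have h2 : ∀ i, η.e (j, false) * (t i * star p) = 0 := fun i => by
      rw [← mul_assoc, η.mul_eq_zero_of (by simp) (η.e_mul_self (j, false)) (ht i), zero_mul]
    rw [ha', mul_add, ← mul_assoc, hgb', mul_add, Finset.mul_sum,
      Finset.sum_eq_zero fun i _ => h2 i, h1, add_zero, zero_mul, add_zero]
  -- The error `r` sees only the negative entries, which `g` does not change, so its contribution
  -- stays in the new left ideal.
  have hrS : ∀ y, y * r * a ∈ S := fun y => by
    have : y * r * a = ∑ j, y * r * (η.e (j, false) * a') := by
      rw [← hr1, ← Finset.mul_sum]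
      simp only [hneg, ← Finset.sum_mul]
      rw [← eNeg, hr1]
      nth_rw 1 [← hr1]
      simp only [mul_assoc]
    rw [this]
    exact sum_mem fun j _ => hSm _ _
  have hlast : ∀ y, y * η.e (Fin.last d, true) * a ∈ S := fun y => by
    have h : y * η.e (Fin.last d, true) * a
        = y * (η.e (Fin.last d, true) * a') - y * η.e (Fin.last d, true) * r * a := by
      have h2 : ∑ i, η.e (Fin.last d, true) * (t i * star p) = 0 :=
        Finset.sum_eq_zero fun i _ => by
          rw [← mul_assoc, hg0 _ _ i (Fin.castSucc_lt_last i).ne' (η.e_mul_self _), zero_mul]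
      rw [ha', mul_add, ← mul_assoc (η.e _) g.beta, hgb', mul_add (η.e _) (∑ i, _), Finset.mul_sum, h2, zero_add]
      simp only [mul_add, mul_assoc]
      abel
    rw [h]
    exact sub_mem (hSm _ _) (hrS _)
  have hentry : ∀ i : Fin d, M.E o i.castSucc * a + b i * (star p * a) ∈ S := fun i => by
    have h : M.E o i.castSucc * a + b i * (star p * a)
        = M.E o i.castSucc * (η.e (i.castSucc, true) * a') - M.E o i.castSucc * r * a := by
      have h2 : ∑ j, M.E o i.castSucc * (t j * star p) = b i * star p := by
        rw [Finset.sum_eq_single i]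
        · simp only [t, ← mul_assoc, M.mul, M.diag]; rw [← he₁, hb1]
        · intro j _ hj
          rw [← mul_assoc, hg0 _ _ j (fun h => hj (Fin.castSucc_injective d h).symm) (M.mul_e _ _), zero_mul]
        · simp
      rw [← mul_assoc (M.E _ _) (η.e _), M.mul_e, ha', mul_add, ← mul_assoc _ g.beta, hgb', mul_add, Finset.mul_sum,
        h2, add_mul, mul_assoc]
      abel
    rw [h]
    exact sub_mem (hSm _ _) (hrS _)
  have hT : ∀ y, y * T ∈ S := fun y => by
    refine mul_mem_leftSpan _ (add_mem (sum_mem fun j _ => ?_) (hlast s))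
    rw [mul_assoc, ← hneg]
    exact hSm _ _
  -- Each shortened term is a new entry up to errors in `S`, plus `b i * T`. The latter is also in
  -- `S`, hence so is the combination equal to `e₁`.
  rw [← hY]
  refine sum_mem fun i _ => mul_mem_leftSpan _ ?_
  have h : x i.castSucc + b i * x (Fin.last d)
      = (M.E o i.castSucc * a + b i * (star p * a)) + b i * T := by
    rw [hx1, hx2, hc1, mul_add, ← mul_assoc (b i), hb2, ← mul_assoc (b i) e₁, hb2, add_assoc]
  change x i.castSucc + b i * x (Fin.last d) ∈ S
  rw [h]
  exact add_mem (hentry i) (hT _)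

theorem e_pos (i : Fin (d + 1)) : η.e (i, true) = (η.pair i).ep := rfl

theorem e_neg (i : Fin (d + 1)) : η.e (i, false) = (η.pair i).em := rfl

/-- Under the `Λ`-stable rank condition, the positive part of a vector with unimodular hyperbolic
part can be made unimodular. -/
theorem exists_unimodular_positive_part (M : η.MatrixUnits) (hsr : η.LambdaStableRankLE o d) {a : R}
    (ha : a * η.e (o, true) = a) (hu : η.e (o, true) ∈ leftSpan fun k => η.e k * a) :
    ∃ g ∈ η.EU, IsRightUnimodular (η.e (o, true)) fun i => M.E o i * (a + g.beta * a) := by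
  obtain ⟨y, hy⟩ := hu
  have hsr := hsr.2
  simp only [← e_pos, ← e_neg] at hsr
  obtain ⟨A, hA, hAs, hAd, hAu⟩ := hsr (fun i => M.E o i * a) (fun i => star (M.E i o) * a)
    (fun i => by rw [← mul_assoc, M.e_mul, mul_assoc, ha])
    (fun i => by rw [← mul_assoc, M.e_mul_star, mul_assoc, ha])
    ⟨fun i => η.e (o, true) * y (i, true) * M.E i o,
      fun i => η.e (o, true) * y (i, false) * star (M.E o i),
      fun i => by simp only [mul_assoc, M.mul_e]; rw [← mul_assoc, e_mul_self],
      fun i => by simp only [mul_assoc, M.star_mul_e]; rw [← mul_assoc, e_mul_self], by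
        have h1 : ∀ i, η.e (o, true) * y (i, false) * star (M.E o i) * (star (M.E i o) * a)
            = η.e (o, true) * (y (i, false) * (η.e (i, false) * a)) := fun i => by
          rw [← M.star_diag, ← M.star_mul_star i o i]; simp only [mul_assoc]
        have h2 : ∀ i, η.e (o, true) * y (i, true) * M.E i o * (M.E o i * a)
            = η.e (o, true) * (y (i, true) * (η.e (i, true) * a)) := fun i => by
          rw [← M.diag i, ← M.mul i o i]; simp only [mul_assoc]
        simp only [h1, h2]
        rw [← Finset.sum_add_distrib]
        simp only [← mul_add]
        rw [← Finset.mul_sum]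
        rw [Fintype.sum_prod_type] at hy
        simp only [Fintype.sum_bool] at hy
        simp only [add_comm (y (_, false) * _)]
        rw [hy, e_mul_self]⟩
  have hAl := fun i j => η.left_of_corner (hA i j)
  have hAr := fun i j => η.right_of_corner (hA i j)
  obtain ⟨g, hg, hb⟩ := η.exists_beta_block (fun i j => M.E i o * A i j * star (M.E j o))
    (fun i j => by
      simp only [mul_assoc, M.star_mul_e]
      rw [← mul_assoc, M.e_mul])
    (fun i j => by
      rw [star_mul, star_mul, star_star, hAs j i]
      simp only [mul_assoc, mul_neg, neg_mul])
    (fun i => by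
      obtain ⟨u, hu0, huρ⟩ := hAd i
      -- Acting by `star (M.E i o)` carries `A i i = ρ(u · e)` to `E_{io} A_{ii} star(E_{io})`, the
      -- `i`-th diagonal entry of the block.
      refine ⟨act (act u (∑ i, (η.pair i).eAbs)) (star (M.E i o)), ?_, ?_, ?_⟩
      · rw [pi_act, hu0, zero_mul]
      · rw [← act_mul, M.star_mul_e]
      · rw [rho_act, huρ, star_star])
  refine ⟨g, hg, ?_⟩
  convert hAu using 2 with i
  rw [mul_add]
  congr 1
  rw [hb, ← mul_assoc, Finset.mul_sum, Finset.sum_eq_single i, Finset.mul_sum, Finset.sum_mul]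
  · refine Finset.sum_congr rfl fun j _ => ?_
    simp only [← mul_assoc, M.mul, M.diag, hAl]
  · intro j _ hj
    rw [Finset.mul_sum]
    refine Finset.sum_eq_zero fun k _ => ?_
    rw [mul_assoc, ← mul_assoc, M.mul_eq_zero hj.symm, zero_mul]
  · simp

/-- Under the stable rank condition, a vector with unimodular positive part can be moved to a
vector whose last positive entry is the standard one. -/
theorem exists_last_entry_eq (M : η.MatrixUnits) (hsr : StableRankLE (η.e (o, true)) d) {a : R}
    (ha : a * η.e (o, true) = a)
    (hu : IsRightUnimodular (η.e (o, true)) fun i => M.E o i * a) :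
    ∃ g ∈ η.EU, η.e (Fin.last d, true) * (a + g.beta * a) = M.E (Fin.last d) o := by
  classical
  set l := Fin.last d
  obtain ⟨b, hb, Y, hYc, hY⟩ := hsr _
    (fun i => by rw [← mul_assoc, M.e_mul, mul_assoc, ha]) hu
  have hb1 := fun i => η.left_of_corner (hb i)
  -- This column adds `b i` times the last entry to the others, so that the first `d` entries become
  -- unimodular alone.
  let x : Fin d → R := fun i => M.E i.castSucc o * b i * M.E o l
  have hx : ∀ i, η.e (i.castSucc, true) * x i * η.e (l, true) = x i := fun i => by
    simp only [x, mul_assoc, M.mul_e]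
    rw [← mul_assoc, M.e_mul]
  obtain ⟨g, hg, hgb⟩ := η.exists_beta_column Finset.univ Fin.castSucc l x
    (fun i => (Fin.castSucc_lt_last i).ne) hx
  have hga : ∀ i : Fin d, M.E o i.castSucc * (a + g.beta * a)
      = M.E o i.castSucc * a + b i * (M.E o l * a) := fun i => by
    rw [mul_add, ← mul_assoc _ g.beta]
    congr 1
    rw [hgb, Finset.mul_sum, Finset.sum_eq_single i]
    · have h : M.E o i.castSucc * star (x i) = 0 :=
        η.mul_eq_zero_of (by simp [opp]) (M.mul_e _ _) (η.star_right (η.right_of_corner (hx i)))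
      rw [mul_sub, h, sub_zero]
      simp only [x, ← mul_assoc, M.mul, M.diag, hb1]
    · intro j _ hj
      have h1 : M.E o i.castSucc * x j = 0 :=
        η.mul_eq_zero_of (by simpa using hj.symm) (M.mul_e _ _) (η.left_of_corner (hx j))
      have h2 : M.E o i.castSucc * star (x j) = 0 :=
        η.mul_eq_zero_of (by simp [opp]) (M.mul_e _ _) (η.star_right (η.right_of_corner (hx j)))
      rw [mul_sub, h1, h2, sub_zero]
    · simp
  replace hY : ∑ i, Y i * (M.E o i.castSucc * (a + g.beta * a)) = η.e (o, true) := by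
    simpa only [hga] using hY
  have ha' := add_mul_mul_of_mul_eq ha g.beta
  generalize ha'' : a + g.beta * a = a' at *
  -- The row writes the wanted change `E_{lo} - e_l a'` of the last entry as a combination of the
  -- first `d` entries, through their relation with coefficients `Y`.
  let x' : Fin d → R := fun i => (M.E l o - η.e (l, true) * a') * Y i * M.E o i.castSucc
  have hx' : ∀ i, η.e (l, true) * x' i * η.e (i.castSucc, true) = x' i := fun i => by
    simp only [x', mul_assoc, M.mul_e]
    rw [← mul_assoc, mul_sub, M.e_mul, ← mul_assoc (η.e _) (η.e _), e_mul_self]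
  obtain ⟨g', hg', hgb'⟩ := η.exists_beta_row Finset.univ Fin.castSucc l x'
    (fun i => (Fin.castSucc_lt_last i).ne) hx'
  refine ⟨g' * g, mul_mem hg' hg, ?_⟩
  rw [OddUnitary.beta_mul_vec, ha'', mul_add, ← mul_assoc (η.e _) g'.beta, hgb', Finset.mul_sum (Finset.univ : Finset (Fin d))]
  have h : ∀ i, η.e (l, true) * (x' i - star (x' i)) = x' i := fun i => by
    have h2 : η.e (l, true) * star (x' i) = 0 :=
      η.mul_eq_zero_of (by simp [opp]) (η.e_mul_self _) (η.star_right (η.right_of_corner (hx' i)))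
    rw [mul_sub, h2, sub_zero, η.left_of_corner (hx' i)]
  rw [Finset.sum_congr rfl fun i _ => h i, Finset.sum_mul]
  simp only [mul_assoc]
  rw [← Finset.mul_sum, hY, sub_mul, M.mul_e, mul_assoc, ha']
  abel

/-- The composite of the three passes. Unimodularity is witnessed by `π w` with `w` in `Δ`, because
the zero part of the witness has to supply ultrashort parameters. -/
theorem exists_last_entry_eq_of_lambdaStableRankLE (M : η.MatrixUnits) (hsr : η.LambdaStableRankLE o d) {a : R}
    (ha : a * η.e (o, true) = a) {w : Δ} (hw : star (pi w) * a = η.e (o, true)) :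
    ∃ g ∈ η.EU, η.e (Fin.last d, true) * (a + g.beta * a) = M.E (Fin.last d) o := by
  obtain ⟨g₁, hg₁, h₁⟩ := exists_unimodular_hyperbolic_part o M hsr.1 ha hw
  have ha₁ := add_mul_mul_of_mul_eq ha g₁.beta
  obtain ⟨g₂, hg₂, h₂⟩ := exists_unimodular_positive_part o M hsr ha₁ h₁
  rw [← OddUnitary.beta_mul_vec] at h₂
  have ha₂ := add_mul_mul_of_mul_eq ha (g₂ * g₁).beta
  obtain ⟨g₃, hg₃, h₃⟩ := exists_last_entry_eq o M hsr.1 ha₂ h₂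
  rw [← OddUnitary.beta_mul_vec] at h₃
  exact ⟨_, mul_mem hg₃ (mul_mem hg₂ hg₁), h₃⟩

end Rank

end OrthogonalHyperbolicFamily

/-! ### Isometries between hermitian idempotents -/

namespace UnitaryBetween

variable {R Δ : Type*} [NonUnitalRing R] [StarRing R] [AddGroup Δ] [OddFormRing R Δ] {n : ℕ}
  {η : OrthogonalHyperbolicFamily R Δ n} {ε : R}

/-- The image of `q_k` under a unitary element of `U(ε, e_{|k|})`, as a vector in `Δ`. -/
theorem exists_isotropic {k : Fin n × Bool} (X : UnitaryBetween Δ ε (η.pair k.1).eAbs) :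
    ∃ v : Δ, act v (η.e k) = v ∧ rho v = (0 : R) ∧
      pi v = (X.beta + (η.pair k.1).eAbs) * η.e k := by
  refine ⟨act X.gamma (η.e k) + η.q k, ?_, ?_, ?_⟩
  · rw [act_add_left, ← act_mul, η.e_mul_self, η.act_q]
  · rw [rho_add, rho_act, X.rho_gamma, pi_act, X.pi_gamma, η.pi_q, η.rho_q, mul_assoc, mul_assoc,
      η.eAbs_mul_e, StarMul.star_mul, mul_assoc, sub_self, zero_add]
  · rw [pi_add, pi_act, X.pi_gamma, η.pi_q, add_mul, η.eAbs_mul_e]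

end UnitaryBetween

/-- A unitary element restricts to an isometry between `e` and its conjugate. -/
def OddUnitary.toUnitaryBetween {R Δ : Type*} [NonUnitalRing R] [StarRing R] [AddGroup Δ]
    [OddFormRing R Δ] (g : OddUnitary R Δ) {e : R} (he : e * e = e) (hs : star e = e) :
    UnitaryBetween Δ (g.conjRing e) e :=
  have h2 : ∀ x, e * (e * x) = e * x := fun x => by rw [← mul_assoc, he]
  have h1 : star (g.beta * e + e) * (g.beta * e + e) = e := by
    have h : star (g.beta * e + e) * (g.beta * e + e)
        = e * (star g.beta * g.beta + g.beta + star g.beta) * e + e * e := by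
      rw [star_add, star_mul, hs]
      simp only [add_mul, mul_add, mul_assoc, he]
      abel
    rw [h, g.star_mul_beta, mul_zero, zero_mul, zero_add, he]
  have h3 : (g.beta * e + e) * star (g.beta * e + e) = g.conjRing e := by
    rw [star_add, star_mul, hs, OddUnitary.conjRing]
    simp only [add_mul, mul_add, mul_assoc, he, h2]
    abel
  { beta := g.beta * e
    gamma := act g.gamma e
    alpha_mem := by
      rw [← h3, mul_assoc _ (star _), h1, add_mul, mul_assoc, he, add_mul, mul_assoc, he]
    star_mul := h1
    mul_star := h3
    gamma_mem := ⟨_, rfl⟩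
    pi_gamma := by rw [pi_act, g.pi_gamma]
    rho_gamma := by rw [rho_act, g.rho_gamma, star_mul] }

namespace HyperbolicPair

variable {R Δ : Type*} [NonUnitalRing R] [StarRing R] [AddGroup Δ] [OddFormRing R Δ]
  (p : HyperbolicPair R Δ)

theorem eAbs_mul_self : p.eAbs * p.eAbs = p.eAbs := by
  simp [eAbs, add_mul, mul_add, p.em_idem, p.ep_idem, p.em_mul_ep, p.ep_mul_em]

theorem star_eAbs : star p.eAbs = p.eAbs := by
  have h : star p.em = p.ep := by rw [← p.star_ep, star_star]
  rw [eAbs, star_add, p.star_ep, h, add_comm]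

end HyperbolicPair

/-! ### Transitivity on idempotents isometric to the last hyperbolic plane -/

namespace OrthogonalHyperbolicFamily

variable {R Δ : Type*} [NonUnitalRing R] [StarRing R] [AddGroup Δ] [OddFormRing R Δ] {d : ℕ}
  {η : OrthogonalHyperbolicFamily R Δ (d + 1)}

/-- The elementary group moves every hermitian idempotent isometric to the last hyperbolic plane
to that plane. -/
theorem exists_conjRing_eq (hη : η.IsFree) (o : Fin (d + 1)) (hsr : η.LambdaStableRankLE o d)
    {ε : R} (X : UnitaryBetween Δ ε (η.pair (Fin.last d)).eAbs) :
    ∃ g ∈ η.EU, g.conjRing ε = (η.pair (Fin.last d)).eAbs := by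
  obtain ⟨M⟩ := hη.nonempty_matrixUnits
  set l := Fin.last d
  obtain ⟨v, hv, hvρ, hvπ⟩ := X.exists_isotropic (k := (l, true))
  obtain ⟨w, hw, hwρ, hwπ⟩ := X.exists_isotropic (k := (l, false))
  simp only at hvπ hwπ
  have hstar : star (η.e (l, false)) = η.e (l, true) := η.star_e _
  have hstar' : star (η.e (l, true)) = η.e (l, false) := η.star_e _
  have hpair : star (pi w) * pi v = η.e (l, true) := by
    rw [hvπ, hwπ, star_mul, hstar, mul_assoc, ← mul_assoc (star _), X.star_mul,
      η.eAbs_mul_e (l, true), e_mul_self]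
  have hve : pi v * η.e (l, true) = (pi v : R) := by rw [← pi_act, hv]
  -- The rank condition concerns the corner at `o`, so the column is transported by `E_{lo}` and
  -- brought back afterwards by `E_{ol}`.
  obtain ⟨g₁, hg₁, h₁⟩ := exists_last_entry_eq_of_lambdaStableRankLE o M hsr
    (a := pi v * M.E l o) (w := act w (star (M.E o l)))
    (by rw [mul_assoc, M.mul_e])
    (by rw [pi_act, star_mul, star_star, mul_assoc, ← mul_assoc (star (pi w)), hpair, M.e_mul,
      M.mul, M.diag])
  have h₁' : η.e (l, true) * pi (g₁.vecAct v) = η.e (l, true) := by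
    have h := congrArg (· * M.E o l) h₁
    simp only [M.mul, M.diag, mul_assoc, add_mul, hve] at h
    rw [OddUnitary.pi_vecAct, h, M.diag]
  obtain ⟨g₂, hg₂, h₂, -⟩ := η.exists_reduce_of_entry_eq (v := g₁.vecAct v)
    (by rw [OddUnitary.act_vecAct, hv]) (by rw [OddUnitary.rho_vecAct, hvρ]) h₁'
  rw [← OddUnitary.pi_vecAct] at h₂
  set w₂ := g₂.vecAct (g₁.vecAct w) with hw₂
  -- The image of `v` is now `e_l`, so the preserved pairing reads `star (π w₂) * e_l = e_l`, whose
  -- adjoint is the claim.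
  have h₃ : η.e (l, false) * pi w₂ = η.e (l, false) := by
    have h := g₂.star_mul_pi_vecAct (g₁.vecAct w) (g₁.vecAct v)
    rw [h₂, OddUnitary.star_mul_pi_vecAct, hpair, ← hw₂] at h
    have h' := congrArg star h
    rwa [star_mul, star_star, hstar'] at h'
  obtain ⟨g₃, hg₃, h₄, h₅⟩ := η.exists_reduce_of_entry_eq (v := w₂)
    (by rw [hw₂, OddUnitary.act_vecAct, OddUnitary.act_vecAct, hw])
    (by rw [hw₂, OddUnitary.rho_vecAct, OddUnitary.rho_vecAct, hwρ]) h₃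
  -- The opposite of the index `-l` is `l`, so the element reducing `w₂` does not disturb the
  -- already standard image of `v`.
  change g₃.beta * η.e (l, true) = 0 at h₅
  set g := g₃ * (g₂ * g₁) with hg
  have hgv : pi v + g.beta * pi v = η.e (l, true) := by
    rw [hg, OddUnitary.beta_mul_vec, OddUnitary.beta_mul_vec, ← OddUnitary.pi_vecAct,
      ← OddUnitary.pi_vecAct, h₂, h₅, add_zero]
  have hgw : pi w + g.beta * pi w = η.e (l, false) := by
    rw [hg, OddUnitary.beta_mul_vec, OddUnitary.beta_mul_vec, ← OddUnitary.pi_vecAct,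
      ← OddUnitary.pi_vecAct, ← hw₂, h₄]
  have hα : X.beta + (η.pair l).eAbs = pi w + pi v := by
    rw [hvπ, hwπ, ← mul_add]
    change _ = _ * (η.pair l).eAbs
    nth_rw 2 [← X.alpha_mem]
    rw [mul_assoc, (η.pair l).eAbs_mul_self, X.alpha_mem]
  refine ⟨g, mul_mem hg₃ (mul_mem hg₂ hg₁), ?_⟩
  have hgα : (pi w + pi v) + g.beta * (pi w + pi v) = (η.pair l).eAbs := by
    rw [mul_add, add_add_add_comm, hgv, hgw]; rfl
  have hε : g.conjRing ε = ((pi w + pi v) + g.beta * (pi w + pi v))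
      * star ((pi w + pi v) + g.beta * (pi w + pi v)) := by
    rw [← X.mul_star, hα, OddUnitary.conjRing]
    generalize (pi w + pi v : R) = α
    rw [star_add, star_mul]
    noncomm_ring
  rw [hε, hgα, (η.pair l).star_eAbs, (η.pair l).eAbs_mul_self]

end OrthogonalHyperbolicFamily

theorem mainTheorem5 {S Θ R Δ : Type*}
    [NonUnitalRing S] [StarRing S] [AddGroup Θ] [OddFormRing S Θ]
    [NonUnitalRing R] [StarRing R] [AddGroup Δ] [OddFormRing R Δ]
    {m n : ℕ} (hm : 1 ≤ m) (hn : 1 ≤ n)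
    (ζ : OrthogonalHyperbolicFamily S Θ m) (hζ : ζ.IsFree)
    (η : OrthogonalHyperbolicFamily R Δ n) (hη : η.IsFree)
    (hsr : η.LambdaStableRankLE ⟨0, hn⟩ (n - 1)) :
    HomStar ζ η ⟨m - 1, Nat.sub_one_lt_of_lt hm⟩ ⟨n - 1, Nat.sub_one_lt_of_lt hn⟩ =
      (η.EU : Set (OddUnitary R Δ)) •
        HomAt ζ η ⟨m - 1, Nat.sub_one_lt_of_lt hm⟩ ⟨n - 1, Nat.sub_one_lt_of_lt hn⟩ := by
  obtain ⟨d, rfl⟩ : ∃ d, n = d + 1 := ⟨n - 1, by omega⟩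
  ext f
  rw [Set.mem_smul]
  constructor
  · rintro ⟨X⟩
    obtain ⟨g, hg, h⟩ := OrthogonalHyperbolicFamily.exists_conjRing_eq hη _ hsr X
    -- The element `g` makes `g • f` standard, so `f` is recovered from it by `g⁻¹`.
    exact ⟨g⁻¹, inv_mem hg, g • f, h, inv_smul_smul g f⟩
  · rintro ⟨g, -, h, hh, rfl⟩
    change Nonempty (UnitaryBetween Δ (g.conjRing (h.toRing _)) _)
    rw [show h.toRing _ = _ from hh]
    exact ⟨g.toUnitaryBetween (HyperbolicPair.eAbs_mul_self _) (HyperbolicPair.star_eAbs _)⟩
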